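/- \textbf{Setup.} For each $N\ge 1$ let $W_N$ be the random symmetric $N\times N$ matrix with $W_N(j,\ell)=X_{j\wedge \ell,\,j\vee \ell}$, where $\{X_{j,\ell}:1\le j\le \ell\le N\}$ (which may depend on $N$) are independent random variables with mean $0$ and variance $f(j/N,\ell/N)$, for a fixed bounded Riemann-integrable function $f:[0,1]^2\to[0,\infty)$, and suppose that for some $B_0>0$, not depending on $N,j,\ell$, one has $\mathbb E|X_{j,\ell}|^m\le m^{B_0m}$ for all integers $m\ge1$. Fix $k\ge 1$, constants $\alpha_1>\dots>\alpha_k>0$ and functions $h_1,\dots,h_k:[0,1]\to\mathbb R$, let $\theta=\theta_N>0$, and put $$e_i=\tfrac1{\sqrt N}\bigl(h_i(1/N),h_i(2/N),\dots,h_i(1)\bigr)'\in\mathbb R^N,\qquad A=A_N=W_N+\theta_N\sum_{i=1}^k\alpha_i\,e_ie_i'.$$ Write $\lambda_1(M)\ge\lambda_2(M)\ge\cdots$ for the ordered eigenvalues of a real symmetric matrix $M$. Assume: (A1) there is $\xi>\max\{4(B_0+1),8\}$ with $\sqrt N(\log N)^{\xi}=O(\theta_N)$ and $\theta_N=O(N)$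 as $N\to\infty$; (A2) $h_1,\dots,h_k$ are bounded and orthonormal in $L^2[0,1]$, and $e_1,\dots,e_k$ are asymptotically orthonormal: $e_j'e_\ell\to\mathbf 1(j=\ell)$ as $N\to\infty$ (which is automatic if the $h_i$ are Riemann integrable). \textbf{Theorem (asymptotic behavior of the eigenvalue mean).} Assume in addition that $N^{2/3}=o(\theta_N)$. Fix $1\le i\le k$ and let $B=B_N$ be the deterministic $k\times k$ matrix (depending on $i$) with entries $$B(j,\ell)=\sqrt{\alpha_j\alpha_\ell}\,\theta\,e_j'e_\ell+\frac{\sqrt{\alpha_j\alpha_\ell}\;\mathbb E(e_j'W^2e_\ell)}{\theta\,\alpha_i^2},\qquad 1\le j,\ell\le k.$$ Then $\lambda_i(A)$ is integrable and, as $N\to\infty$, $$\mathbb E\bigl(\lambda_i(A)\bigr)=\lambda_i(B)\left(1+O\!\left(\frac{N^2}{\theta^3}\right)\right).$$ -/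

import Mathlib

open MeasureTheory ProbabilityTheory Filter Asymptotics

namespace SpikedWigner

/-- The `(i+1)`-th largest eigenvalue `λ_{i+1}(M)`, with multiplicity, of a real symmetric
`n × n` matrix (`i` is counted from `0`; the value is `0` when there is no such eigenvalue). -/
noncomputable def orderedEigenvalue {n : ℕ} {M : Matrix (Fin n) (Fin n) ℝ}
    (hM : M.IsHermitian) (i : ℕ) : ℝ :=
  if hi : i < n then hM.eigenvalues₀ ⟨i, by simpa using hi⟩ else 0

/-- The grid point `(l+1)/N` of `[0,1]` that belongs to the index `l ∈ {0, …, N-1}`. -/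
noncomputable def gridPoint {N : ℕ} (l : Fin N) : ℝ := ((l : ℕ) + 1 : ℝ) / N

/-- The discretization `e = N^{-1/2} (h(1/N), h(2/N), …, h(1))` of a function `h` on `[0,1]`. -/
noncomputable def discretize (N : ℕ) (h : ℝ → ℝ) : Fin N → ℝ :=
  fun l => h (gridPoint l) / Real.sqrt N

/-- The symmetric matrix `W(j,l) = x_{j ∧ l, j ∨ l}`. -/
def symmMatrix {N : ℕ} (x : Fin N → Fin N → ℝ) : Matrix (Fin N) (Fin N) ℝ :=
  Matrix.of fun j l => x (min j l) (max j l)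

/-- The perturbed matrix `A = W + θ ∑ i, α_i e_i e_i'`. -/
noncomputable def perturbedMatrix {N k : ℕ} (x : Fin N → Fin N → ℝ) (θ : ℝ) (α : Fin k → ℝ)
    (h : Fin k → ℝ → ℝ) : Matrix (Fin N) (Fin N) ℝ :=
  symmMatrix x +
    θ • ∑ i, α i • Matrix.vecMulVec (discretize N (h i)) (discretize N (h i))

/-- The deterministic `k × k` matrix `B` that belongs to the index `i`:
`B(j,l) = √(α_j α_l) θ e_j'e_l + √(α_j α_l) E(e_j'W²e_l) / (θ α_i²)`. -/
noncomputable def meanMatrix {N k : ℕ} {Ω : Type*} [MeasurableSpace Ω] (P : Measure Ω)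
    (X : Fin N → Fin N → Ω → ℝ) (θ : ℝ) (α : Fin k → ℝ) (h : Fin k → ℝ → ℝ) (i : Fin k) :
    Matrix (Fin k) (Fin k) ℝ :=
  Matrix.of fun j l =>
    Real.sqrt (α j * α l) * θ * (discretize N (h j) ⬝ᵥ discretize N (h l)) +
      Real.sqrt (α j * α l) *
        (∫ ω, discretize N (h j) ⬝ᵥ
          ((symmMatrix fun a b => X a b ω) ^ 2).mulVec (discretize N (h l)) ∂P) /
        (θ * α i ^ 2)

theorem symmMatrix_isHermitian {N : ℕ} (x : Fin N → Fin N → ℝ) :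
    (symmMatrix x).IsHermitian := by
  ext j l
  simp [symmMatrix, min_comm, max_comm]

theorem perturbedMatrix_isHermitian {N k : ℕ} (x : Fin N → Fin N → ℝ) (θ : ℝ) (α : Fin k → ℝ)
    (h : Fin k → ℝ → ℝ) : (perturbedMatrix x θ α h).IsHermitian := by
  refine (symmMatrix_isHermitian x).add ?_
  ext j l
  simp [Matrix.sum_apply, Matrix.vecMulVec_apply, mul_comm]

theorem meanMatrix_isHermitian {N k : ℕ} {Ω : Type*} [MeasurableSpace Ω] (P : Measure Ω)
    (X : Fin N → Fin N → Ω → ℝ) (θ : ℝ) (α : Fin k → ℝ) (h : Fin k → ℝ → ℝ) (i : Fin k) :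
    (meanMatrix P X θ α h i).IsHermitian := by
  ext j l
  have key : ∀ ω, discretize N (h l) ⬝ᵥ
        ((symmMatrix fun a b => X a b ω) ^ 2).mulVec (discretize N (h j)) =
      discretize N (h j) ⬝ᵥ
        ((symmMatrix fun a b => X a b ω) ^ 2).mulVec (discretize N (h l)) := by
    intro ω
    have hs : ((symmMatrix fun a b => X a b ω) ^ 2).transpose =
        (symmMatrix fun a b => X a b ω) ^ 2 := by
      have := (symmMatrix_isHermitian fun a b => X a b ω).pow 2
      simpa [Matrix.IsHermitian, Matrix.conjTranspose_eq_transpose_of_trivial] using this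
    rw [Matrix.dotProduct_mulVec, ← Matrix.mulVec_transpose, hs, dotProduct_comm]
  simp only [meanMatrix, Matrix.conjTranspose_apply, Matrix.of_apply, star_trivial]
  simp only [key, mul_comm (α l) (α j), dotProduct_comm (discretize N (h l))]

/-- `f` is a bounded Riemann-integrable function `[0,1]² → [0,∞)`
(its values off the unit square are irrelevant). -/
structure IsVarianceProfile (f : ℝ → ℝ → ℝ) : Prop where
  nonneg : ∀ x ∈ Set.Icc (0 : ℝ) 1, ∀ y ∈ Set.Icc (0 : ℝ) 1, 0 ≤ f x y
  bounded : ∃ C, ∀ x ∈ Set.Icc (0 : ℝ) 1, ∀ y ∈ Set.Icc (0 : ℝ) 1, f x y ≤ C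
  riemannIntegrable :
    BoxIntegral.Integrable (⟨0, 1, fun _ => zero_lt_one⟩ : BoxIntegral.Box (Fin 2))
      BoxIntegral.IntegrationParams.Riemann (fun z : Fin 2 → ℝ => f (z 0) (z 1))
      BoxIntegral.BoxAdditiveMap.volume

/-- The entries `X_{j,l}`, `j ≤ l`, of the `N × N` matrix `W` are independent centred random
variables with variances `f(j/N, l/N)` and with `E|X_{j,l}|^m ≤ m^{Bm}` for all `m ≥ 1`. -/
structure IsWignerArray {N : ℕ} {Ω : Type*} [MeasurableSpace Ω] (P : Measure Ω)
    (X : Fin N → Fin N → Ω → ℝ) (f : ℝ → ℝ → ℝ) (B : ℝ) : Prop where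
  measurable : ∀ j l, j ≤ l → Measurable (X j l)
  indep : iIndepFun (fun (p : {p : Fin N × Fin N // p.1 ≤ p.2}) => X p.1.1 p.1.2) P
  mean_zero : ∀ j l, j ≤ l → ∫ ω, X j l ω ∂P = 0
  variance_eq : ∀ j l, j ≤ l → variance (X j l) P = f (gridPoint j) (gridPoint l)
  moment : ∀ j l, j ≤ l → ∀ m : ℕ, 1 ≤ m →
    Integrable (fun ω => |X j l ω| ^ m) P ∧
      ∫ ω, |X j l ω| ^ m ∂P ≤ (m : ℝ) ^ (B * (m : ℝ))

/-- Growth of the perturbation: for some `ξ > max (4 (B+1)) 8`,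
`√N (log N)^ξ = O(θ_N)` and `θ_N = O(N)`. -/
def GrowthCondition (θ : ℕ → ℝ) (B : ℝ) : Prop :=
  ∃ ξ : ℝ, max (4 * (B + 1)) 8 < ξ ∧
    (fun N : ℕ => Real.sqrt N * Real.log N ^ ξ) =O[atTop] θ ∧
    θ =O[atTop] fun N : ℕ => (N : ℝ)

/-- `h_1, …, h_k` are bounded functions on `[0,1]`, orthonormal in `L²[0,1]`, whose
discretizations are asymptotically orthonormal. The last field is automatic for
Riemann-integrable `h_i`; without it the values of the `h_i` on the rational grid
are unrelated to their classes in `L²[0,1]`. -/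
structure OrthonormalSignals {k : ℕ} (h : Fin k → ℝ → ℝ) : Prop where
  bounded : ∀ i, ∃ C, ∀ x ∈ Set.Icc (0 : ℝ) 1, |h i x| ≤ C
  memLp : ∀ i, MemLp (h i) 2 (volume.restrict (Set.Icc (0 : ℝ) 1))
  orthonormal : ∀ i j,
    ∫ x in Set.Icc (0 : ℝ) 1, h i x * h j x = if i = j then 1 else 0
  asymptotically_orthonormal : ∀ i j,
    Tendsto (fun N : ℕ => discretize N (h i) ⬝ᵥ discretize N (h j)) atTop
      (nhds (if i = j then 1 else 0))

end SpikedWigner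

namespace SpikedWigner

open Matrix

/-! Write `A = W + D` with `D = EE'`, where `E` has columns `√(θα_j) e_j`. The matrices `EE'` and
`E'E` share their leading eigenvalues, `E'E` is exactly the first term of `B`, and by asymptotic
orthonormality its eigenvalues lie within `o(θ)` of `θα_j`. Hence `λ_i(D)` is isolated in the
spectrum of `D` by a gap `γ = cθ`. The proof compares both `E λ_i(A)` and `λ_i(B)` with `λ_i(D)`.

For the unit eigenvector `v` of `D`, `exists_abs_orderedEigenvalue_add_sub_le` bounds `λ_i(A) -
λ_i(D) - v'Wv` by a multiple of `|Wv|²/γ + tr(W⁶)/γ⁵`. This holds for every symmetric `W`, so no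
high-probability event has to be split off: where `W` is not small against `γ`, the sixth-power term
pays. As `v` is deterministic, `E v'Wv = 0` and `E|Wv|² = O(N)`; counting closed walks gives `E
tr(W⁶) = O(N⁴)`. So `E λ_i(A) - λ_i(D) = O(N/θ + N⁴/θ⁵)`.

The second term of `B` has entries `O(N/θ)`, so `λ_i(B) - λ_i(D) = O(N/θ)`. Dividing by `λ_i(B) ≥
cθ`, the relative error is `O(N/θ² + N⁴/θ⁶)`. The first term is `O(N²/θ³)` because `θ = O(N)`, the
second because `N² ≤ θ³` eventually. Thus the second-order correction is itself within the allowed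
error and need only be bounded. A fourth power would leave `N³/θ⁴`, which is too large when `θ =
o(N)`; the sixth power suffices. -/

/-! ### Ordered eigenvalues: eigenbases, Courant–Fischer and Weyl bounds. -/

theorem orderedEigenvalue_antitone {n : ℕ} {M : Matrix (Fin n) (Fin n) ℝ} (hM : M.IsHermitian)
    {i j : ℕ} (hij : i ≤ j) (hj : j < n) : orderedEigenvalue hM j ≤ orderedEigenvalue hM i := by
  rw [orderedEigenvalue, orderedEigenvalue, dif_pos hj, dif_pos (hij.trans_lt hj)]
  exact hM.eigenvalues₀_antitone (by simpa using hij)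

theorem orderedEigenvalue_congr {n : ℕ} {M M' : Matrix (Fin n) (Fin n) ℝ} (hM : M.IsHermitian)
    (hM' : M'.IsHermitian) (h : M = M') (i : ℕ) :
    orderedEigenvalue hM i = orderedEigenvalue hM' i := by
  subst h; rfl

/-- A symmetric matrix has an orthonormal basis of eigenvectors, in the order of the
eigenvalues. -/
theorem exists_eigenbasis {n : ℕ} {M : Matrix (Fin n) (Fin n) ℝ} (hM : M.IsHermitian) :
    ∃ u : Fin n → Fin n → ℝ, (∀ i j, u i ⬝ᵥ u j = if i = j then 1 else 0) ∧
      (∀ i, M *ᵥ u i = orderedEigenvalue hM i • u i) ∧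
      ∀ x, x = ∑ i, (u i ⬝ᵥ x) • u i := by
  -- This is the enumeration through which `eigenvalues` reads `eigenvalues₀`, so the reindexed
  -- basis comes in decreasing order of eigenvalues.
  let e : Fin n ≃ Fin n := (finCongr (Fintype.card_fin n).symm).trans
    (Fintype.equivOfCardEq (Fintype.card_fin _))
  let b := hM.eigenvectorBasis.reindex e.symm
  have hin : ∀ x y : EuclideanSpace ℝ (Fin n), inner ℝ x y = x.ofLp ⬝ᵥ y.ofLp := fun x y => by
    rw [EuclideanSpace.inner_eq_star_dotProduct, star_trivial, dotProduct_comm]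
  refine ⟨fun i => (b i).ofLp, fun i j => ?_, fun i => ?_, fun x => ?_⟩
  · rw [← hin, b.inner_eq_ite]
  · have := hM.mulVec_eigenvectorBasis (e i)
    simp only [b, OrthonormalBasis.reindex_apply, Equiv.symm_symm]
    rw [this]
    congr 1
    simp [Matrix.IsHermitian.eigenvalues, orderedEigenvalue, e]
    rfl
  · have := congrArg WithLp.ofLp (b.sum_repr (WithLp.toLp 2 x))
    simp only [b.repr_apply_apply, hin, WithLp.ofLp_sum, WithLp.ofLp_smul] at this
    exact this.symm

section Eigenbasis

variable {n : ℕ} {u : Fin n → Fin n → ℝ}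

theorem dotProduct_eq_sum_of_eigenbasis (hb : ∀ x, x = ∑ i, (u i ⬝ᵥ x) • u i)
    (x y : Fin n → ℝ) : x ⬝ᵥ y = ∑ i, (u i ⬝ᵥ x) * (u i ⬝ᵥ y) := by
  conv_lhs => rw [hb x]
  simp [sum_dotProduct, smul_dotProduct]

theorem dotProduct_mulVec_comm {M : Matrix (Fin n) (Fin n) ℝ} (hM : M.IsHermitian)
    (x y : Fin n → ℝ) : x ⬝ᵥ M *ᵥ y = M *ᵥ x ⬝ᵥ y := by
  have hT : Mᵀ = M := by
    simpa [Matrix.IsHermitian, conjTranspose_eq_transpose_of_trivial] using hM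
  rw [dotProduct_mulVec, ← mulVec_transpose, hT]

theorem dotProduct_mulVec_eq_sum_of_eigenbasis {M : Matrix (Fin n) (Fin n) ℝ}
    (hM : M.IsHermitian) (hb : ∀ x, x = ∑ i, (u i ⬝ᵥ x) • u i)
    (he : ∀ i, M *ᵥ u i = orderedEigenvalue hM i • u i) (x : Fin n → ℝ) :
    x ⬝ᵥ M *ᵥ x = ∑ i : Fin n, orderedEigenvalue hM i * (u i ⬝ᵥ x) ^ 2 := by
  rw [dotProduct_eq_sum_of_eigenbasis hb]
  refine Finset.sum_congr rfl fun i _ => ?_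
  rw [dotProduct_mulVec_comm hM, he, smul_dotProduct, smul_eq_mul]
  ring

end Eigenbasis

theorem exists_ne_zero_forall_dotProduct_eq_zero {n : ℕ} {ι : Type*} [Fintype ι]
    (a : ι → Fin n → ℝ) (h : Fintype.card ι < n) :
    ∃ x : Fin n → ℝ, x ≠ 0 ∧ ∀ t, a t ⬝ᵥ x = 0 := by
  obtain ⟨x, hx, hx0⟩ := (Submodule.ne_bot_iff _).1 <| LinearMap.ker_ne_bot_of_finrank_lt
    (f := (Matrix.of a).mulVecLin) (by simpa using h)
  exact ⟨x, hx0, fun t => congrFun hx t⟩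

theorem dotProduct_self_pos' {n : ℕ} {x : Fin n → ℝ} (hx : x ≠ 0) : 0 < x ⬝ᵥ x := by
  have := dotProduct_star_self_pos_iff (v := x) |>.2 hx
  simpa using this

theorem dotProduct_self_nonneg' {n : ℕ} (x : Fin n → ℝ) : 0 ≤ x ⬝ᵥ x :=
  Finset.sum_nonneg fun _ _ => mul_self_nonneg _

/-- Courant–Fischer upper bound: it is enough to bound the quadratic form on the common kernel of
at most `i` linear forms. -/
theorem orderedEigenvalue_le {n : ℕ} {M : Matrix (Fin n) (Fin n) ℝ} (hM : M.IsHermitian) {i : ℕ}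
    (hi : i < n) {ι : Type*} [Fintype ι] (a : ι → Fin n → ℝ) (hcard : Fintype.card ι ≤ i) {c : ℝ}
    (hc : ∀ x, (∀ t, a t ⬝ᵥ x = 0) → x ⬝ᵥ M *ᵥ x ≤ c * (x ⬝ᵥ x)) :
    orderedEigenvalue hM i ≤ c := by
  obtain ⟨u, -, he, hb⟩ := exists_eigenbasis hM
  -- At most `i` given forms and the `n - 1 - i` eigenvectors after the `i`-th are fewer than `n`
  -- conditions; on such an `x` the form of `M` is at least `λ_i |x|²`.
  obtain ⟨x, hx0, hx⟩ := exists_ne_zero_forall_dotProduct_eq_zero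
    (Sum.elim a fun j : {j : Fin n // ⟨i, hi⟩ < j} => u j) (by
      rw [Fintype.card_sum, Fintype.card_subtype, Finset.filter_lt_eq_Ioi, Fin.card_Ioi]
      simp only
      omega)
  have h1 := hc x fun t => hx (Sum.inl t)
  rw [dotProduct_mulVec_eq_sum_of_eigenbasis hM hb he] at h1
  have h2 : orderedEigenvalue hM i * (x ⬝ᵥ x) ≤
      ∑ j : Fin n, orderedEigenvalue hM j * (u j ⬝ᵥ x) ^ 2 := by
    rw [dotProduct_eq_sum_of_eigenbasis hb, Finset.mul_sum]
    refine Finset.sum_le_sum fun j _ => ?_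
    rcases lt_or_ge (⟨i, hi⟩ : Fin n) j with hj | hj
    · have : u j ⬝ᵥ x = 0 := hx (Sum.inr ⟨j, hj⟩)
      simp [this]
    · rw [← sq]
      exact mul_le_mul_of_nonneg_right (orderedEigenvalue_antitone hM hj hi) (sq_nonneg _)
  exact le_of_mul_le_mul_right (h2.trans h1) (dotProduct_self_pos' hx0)

/-- Courant–Fischer lower bound: it is enough to bound the quadratic form on the common kernel of
fewer than `n - i` linear forms. -/
theorem le_orderedEigenvalue {n : ℕ} {M : Matrix (Fin n) (Fin n) ℝ} (hM : M.IsHermitian) {i : ℕ}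
    {ι : Type*} [Fintype ι] (a : ι → Fin n → ℝ) (hcard : Fintype.card ι + i < n)
    {c : ℝ} (hc : ∀ x, (∀ t, a t ⬝ᵥ x = 0) → c * (x ⬝ᵥ x) ≤ x ⬝ᵥ M *ᵥ x) :
    c ≤ orderedEigenvalue hM i := by
  have hi : i < n := by omega
  obtain ⟨u, -, he, hb⟩ := exists_eigenbasis hM
  obtain ⟨x, hx0, hx⟩ := exists_ne_zero_forall_dotProduct_eq_zero
    (Sum.elim a fun j : {j : Fin n // j < ⟨i, hi⟩} => u j) (by
      rw [Fintype.card_sum, Fintype.card_subtype, Finset.filter_gt_eq_Iio, Fin.card_Iio]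
      exact hcard)
  have h1 := hc x fun t => hx (Sum.inl t)
  rw [dotProduct_mulVec_eq_sum_of_eigenbasis hM hb he] at h1
  have h2 : ∑ j : Fin n, orderedEigenvalue hM j * (u j ⬝ᵥ x) ^ 2 ≤
      orderedEigenvalue hM i * (x ⬝ᵥ x) := by
    rw [dotProduct_eq_sum_of_eigenbasis hb, Finset.mul_sum]
    refine Finset.sum_le_sum fun j _ => ?_
    rcases lt_or_ge j (⟨i, hi⟩ : Fin n) with hj | hj
    · have : u j ⬝ᵥ x = 0 := hx (Sum.inr ⟨j, hj⟩)
      simp [this]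
    · rw [← sq]
      exact mul_le_mul_of_nonneg_right (orderedEigenvalue_antitone hM hj j.2) (sq_nonneg _)
  exact le_of_mul_le_mul_right (h1.trans h2) (dotProduct_self_pos' hx0)

/-- One half of Weyl's inequality. -/
theorem orderedEigenvalue_le_add {n : ℕ} {M M' : Matrix (Fin n) (Fin n) ℝ} (hM : M.IsHermitian)
    (hM' : M'.IsHermitian) {i : ℕ} (hi : i < n) {δ : ℝ}
    (h : ∀ x, x ⬝ᵥ M' *ᵥ x ≤ x ⬝ᵥ M *ᵥ x + δ * (x ⬝ᵥ x)) :
    orderedEigenvalue hM' i ≤ orderedEigenvalue hM i + δ := by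
  obtain ⟨u, -, he, hb⟩ := exists_eigenbasis hM
  refine orderedEigenvalue_le hM' hi (fun j : {j : Fin n // j < ⟨i, hi⟩} => u j) (by
    rw [Fintype.card_subtype, Finset.filter_gt_eq_Iio, Fin.card_Iio]) fun x hx => ?_
  refine (h x).trans ?_
  rw [add_mul, dotProduct_mulVec_eq_sum_of_eigenbasis hM hb he]
  refine add_le_add_left ?_ _
  conv_rhs => rw [dotProduct_eq_sum_of_eigenbasis hb, Finset.mul_sum]
  refine Finset.sum_le_sum fun j _ => ?_
  rcases lt_or_ge j (⟨i, hi⟩ : Fin n) with hj | hj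
  · have : u j ⬝ᵥ x = 0 := hx ⟨j, hj⟩
    simp [this]
  · rw [← sq]
    exact mul_le_mul_of_nonneg_right (orderedEigenvalue_antitone hM hj j.2) (sq_nonneg _)

theorem sq_le_dotProduct_self {n : ℕ} (x : Fin n → ℝ) (j : Fin n) : x j ^ 2 ≤ x ⬝ᵥ x := by
  rw [sq]
  exact Finset.single_le_sum (f := fun l => x l * x l) (fun _ _ => mul_self_nonneg _)
    (Finset.mem_univ j)

theorem abs_dotProduct_mulVec_le {n : ℕ} (M : Matrix (Fin n) (Fin n) ℝ) (x : Fin n → ℝ) :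
    |x ⬝ᵥ M *ᵥ x| ≤ (∑ j, ∑ l, |M j l|) * (x ⬝ᵥ x) := by
  have hx := sq_le_dotProduct_self x
  generalize x ⬝ᵥ x = S at hx ⊢
  simp only [dotProduct, mulVec, Finset.mul_sum, Finset.sum_mul]
  refine (Finset.abs_sum_le_sum_abs _ _).trans (Finset.sum_le_sum fun j _ => ?_)
  refine (Finset.abs_sum_le_sum_abs _ _).trans (Finset.sum_le_sum fun l _ => ?_)
  have h1 := hx j
  have h2 := hx l
  rw [← sq_abs] at h1 h2
  have h3 : |x j| * |x l| ≤ S := by nlinarith [sq_nonneg (|x j| - |x l|)]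
  rw [abs_mul, abs_mul, mul_left_comm]
  exact mul_le_mul_of_nonneg_left h3 (abs_nonneg (M j l))

/-- The eigenvalues are Lipschitz functions of the entries. -/
theorem abs_orderedEigenvalue_sub_le {n : ℕ} {M M' : Matrix (Fin n) (Fin n) ℝ}
    (hM : M.IsHermitian) (hM' : M'.IsHermitian) (i : ℕ) :
    |orderedEigenvalue hM i - orderedEigenvalue hM' i| ≤ ∑ j, ∑ l, |M j l - M' j l| := by
  by_cases hi : i < n
  · have key : ∀ x, |x ⬝ᵥ M *ᵥ x - x ⬝ᵥ M' *ᵥ x| ≤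
        (∑ j, ∑ l, |M j l - M' j l|) * (x ⬝ᵥ x) := fun x => by
      simpa [sub_mulVec, dotProduct_sub] using abs_dotProduct_mulVec_le (M - M') x
    rw [abs_sub_le_iff]
    constructor
    · rw [sub_le_iff_le_add']
      exact orderedEigenvalue_le_add hM' hM hi fun x => by linarith [(abs_le.1 (key x)).2]
    · rw [sub_le_iff_le_add']
      exact orderedEigenvalue_le_add hM hM' hi fun x => by linarith [(abs_le.1 (key x)).1]
  · simp only [orderedEigenvalue, dif_neg hi, sub_self, abs_zero]
    positivity

/-! ### Eigenvalues of diagonal matrices and of `EE'` against `E'E`. -/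

theorem orderedEigenvalue_diagonal {k : ℕ} {α : Fin k → ℝ} (hα : Antitone α)
    (hD : (Matrix.diagonal α).IsHermitian) (i : Fin k) : orderedEigenvalue hD i = α i := by
  have hq : ∀ x, x ⬝ᵥ Matrix.diagonal α *ᵥ x = ∑ j, α j * (x j * x j) := fun x => by
    simp only [dotProduct, mulVec_diagonal]
    exact Finset.sum_congr rfl fun j _ => by ring
  apply le_antisymm
  · refine orderedEigenvalue_le hD i.2 (fun j : {j : Fin k // j < i} => Pi.single j.1 1) (by
      rw [Fintype.card_subtype, Finset.filter_gt_eq_Iio, Fin.card_Iio]) fun x hx => ?_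
    rw [hq, dotProduct, Finset.mul_sum]
    refine Finset.sum_le_sum fun j _ => ?_
    rcases lt_or_ge j i with hj | hj
    · have : x j = 0 := by simpa using hx ⟨j, hj⟩
      simp [this]
    · exact mul_le_mul_of_nonneg_right (hα hj) (mul_self_nonneg _)
  · refine le_orderedEigenvalue hD (fun j : {j : Fin k // i < j} => Pi.single j.1 1) (by
      rw [Fintype.card_subtype, Finset.filter_lt_eq_Ioi, Fin.card_Ioi]; omega) fun x hx => ?_
    rw [hq, dotProduct, Finset.mul_sum]
    refine Finset.sum_le_sum fun j _ => ?_
    rcases lt_or_ge i j with hj | hj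
    · have : x j = 0 := by simpa using hx ⟨j, hj⟩
      simp [this]
    · exact mul_le_mul_of_nonneg_right (hα hj) (mul_self_nonneg _)

theorem dotProduct_sq_le {n : ℕ} (x y : Fin n → ℝ) :
    (x ⬝ᵥ y) ^ 2 ≤ (x ⬝ᵥ x) * (y ⬝ᵥ y) := by
  have := Finset.sum_mul_sq_le_sq_mul_sq Finset.univ x y
  simpa only [dotProduct, sq] using this

/-- Test `EE'` on the `x` orthogonal to `E u_j`, `j < i`, with `u_j` the eigenvectors of `E'E`. Then
`y = E'x` is orthogonal to these `u_j`, and `|y|⁴ = (x·Ey)² ≤ |x|²|Ey|² ≤ λ_i |x|²|y|²`. Applied to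
`E'` as well, this gives equality. -/
theorem orderedEigenvalue_mul_transpose_le {n k : ℕ} (E : Matrix (Fin n) (Fin k) ℝ)
    (h₁ : (E * Eᵀ).IsHermitian) (h₂ : (Eᵀ * E).IsHermitian) {i : ℕ} (hn : i < n) (hk : i < k) :
    orderedEigenvalue h₁ i ≤ orderedEigenvalue h₂ i := by
  obtain ⟨u, ho, he, hb⟩ := exists_eigenbasis h₂
  have hq : ∀ y, y ⬝ᵥ (Eᵀ * E) *ᵥ y = E *ᵥ y ⬝ᵥ E *ᵥ y := fun y => by
    rw [← mulVec_mulVec, dotProduct_mulVec, vecMul_transpose]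
  have hpos : 0 ≤ orderedEigenvalue h₂ i := by
    have h := hq (u ⟨i, hk⟩)
    rw [he, dotProduct_smul, ho, if_pos rfl, smul_eq_mul, mul_one] at h
    rw [show orderedEigenvalue h₂ i = _ from h]
    exact dotProduct_self_nonneg' _
  refine orderedEigenvalue_le h₁ hn (fun j : {j : Fin k // j < ⟨i, hk⟩} => E *ᵥ u j) (by
    rw [Fintype.card_subtype, Finset.filter_gt_eq_Iio, Fin.card_Iio]) fun x hx => ?_
  set y := Eᵀ *ᵥ x with hy
  have h1 : x ⬝ᵥ (E * Eᵀ) *ᵥ x = y ⬝ᵥ y := by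
    rw [← mulVec_mulVec, dotProduct_mulVec, ← mulVec_transpose]
  have h2 : y ⬝ᵥ y = x ⬝ᵥ E *ᵥ y := by rw [dotProduct_mulVec x, ← mulVec_transpose]
  have h3 : E *ᵥ y ⬝ᵥ E *ᵥ y ≤ orderedEigenvalue h₂ i * (y ⬝ᵥ y) := by
    rw [← hq, dotProduct_mulVec_eq_sum_of_eigenbasis h₂ hb he]
    conv_rhs => rw [dotProduct_eq_sum_of_eigenbasis hb, Finset.mul_sum]
    refine Finset.sum_le_sum fun j _ => ?_
    rcases lt_or_ge j (⟨i, hk⟩ : Fin k) with hj | hj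
    · have : u j ⬝ᵥ y = 0 := by
        rw [hy, dotProduct_mulVec, vecMul_transpose]
        exact hx ⟨j, hj⟩
      simp [this]
    · rw [← sq]
      exact mul_le_mul_of_nonneg_right (orderedEigenvalue_antitone h₂ hj j.2) (sq_nonneg _)
  have h4 := dotProduct_sq_le x (E *ᵥ y)
  rw [← h2] at h4
  rw [h1]
  by_cases hy0 : y = 0
  · rw [hy0, dotProduct_zero]
    exact mul_nonneg hpos (dotProduct_self_nonneg' x)
  · have := dotProduct_self_pos' hy0
    have h5 := mul_le_mul_of_nonneg_left h3 (dotProduct_self_nonneg' x)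
    nlinarith

theorem orderedEigenvalue_mul_transpose_eq {n k : ℕ} (E : Matrix (Fin n) (Fin k) ℝ)
    (h₁ : (E * Eᵀ).IsHermitian) (h₂ : (Eᵀ * E).IsHermitian) {i : ℕ} (hn : i < n) (hk : i < k) :
    orderedEigenvalue h₁ i = orderedEigenvalue h₂ i :=
  le_antisymm (orderedEigenvalue_mul_transpose_le E h₁ h₂ hn hk) <| by
    have := orderedEigenvalue_mul_transpose_le Eᵀ (by simpa using h₂) (by simpa using h₁) hk hn
    simpa only [transpose_transpose] using this

/-- The form of `EE'` vanishes on the common kernel of the `k` columns of `E`. -/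
theorem orderedEigenvalue_mul_transpose_nonpos {n k : ℕ} (E : Matrix (Fin n) (Fin k) ℝ)
    (h₁ : (E * Eᵀ).IsHermitian) {i : ℕ} (hn : i < n) (hk : k ≤ i) :
    orderedEigenvalue h₁ i ≤ 0 := by
  refine orderedEigenvalue_le h₁ hn (fun j : Fin k => fun l => E l j) (by simpa using hk)
    fun x hx => ?_
  have : Eᵀ *ᵥ x = 0 := by
    ext j
    exact hx j
  rw [← mulVec_mulVec, this]
  simp

/-! ### Perturbation of an isolated eigenvalue. -/

theorem mulVec_dotProduct_mulVec_le {n : ℕ} (M : Matrix (Fin n) (Fin n) ℝ) (x : Fin n → ℝ) :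
    M *ᵥ x ⬝ᵥ M *ᵥ x ≤ (∑ a, ∑ b, M a b ^ 2) * (x ⬝ᵥ x) := by
  rw [dotProduct, Finset.sum_mul]
  refine Finset.sum_le_sum fun a _ => ?_
  have := dotProduct_sq_le (M a) x
  simpa only [mulVec, ← sq, dotProduct] using this

/-- The quadratic form of `W` is bounded by the sixth root of `‖W³‖²`, for the Frobenius norm. -/
theorem abs_dotProduct_mulVec_le_of_pow_six {n : ℕ} {W : Matrix (Fin n) (Fin n) ℝ}
    (hW : W.IsHermitian) {ρ : ℝ} (hρ : 0 ≤ ρ) (hρ6 : ∑ a, ∑ b, (W ^ 3) a b ^ 2 = ρ ^ 6)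
    (x : Fin n → ℝ) : |x ⬝ᵥ W *ᵥ x| ≤ ρ * (x ⬝ᵥ x) := by
  obtain ⟨u, ho, he, hb⟩ := exists_eigenbasis hW
  have hle : ∀ j : Fin n, |orderedEigenvalue hW j| ≤ ρ := fun j => by
    have h1 := mulVec_dotProduct_mulVec_le (W ^ 3) (u j)
    have h2 : W ^ 3 *ᵥ u j = orderedEigenvalue hW j ^ 3 • u j := by
      rw [pow_succ, pow_two, ← mulVec_mulVec, ← mulVec_mulVec, he, mulVec_smul, mulVec_smul, he,
        mulVec_smul, he, smul_smul, smul_smul]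
      congr 1
      ring
    rw [h2, smul_dotProduct, dotProduct_smul, ho, if_pos rfl, hρ6] at h1
    refine le_of_pow_le_pow_left₀ (n := 6) (by norm_num) hρ ?_
    rw [Even.pow_abs (by decide)]
    simp only [smul_eq_mul, mul_one] at h1
    calc _ = orderedEigenvalue hW j ^ 3 * orderedEigenvalue hW j ^ 3 := by ring
      _ ≤ _ := h1
  rw [dotProduct_mulVec_eq_sum_of_eigenbasis hW hb he, dotProduct_eq_sum_of_eigenbasis hb,
    Finset.mul_sum]
  refine (Finset.abs_sum_le_sum_abs _ _).trans (Finset.sum_le_sum fun j _ => ?_)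
  rw [abs_mul, abs_sq, ← sq]
  exact mul_le_mul_of_nonneg_right (hle j) (sq_nonneg _)

/-- Weighted AM-GM for the cross term; the weight makes it cost half of the gap `γ` on the part
orthogonal to the eigenvector. -/
theorem two_mul_le_of_sq_le {a c s q γ : ℝ} (hγ : 0 < γ) (hs : 0 ≤ s) (hq : 0 ≤ q)
    (hc : c ^ 2 ≤ s * q) : |2 * a * c| ≤ 2 * s / γ * a ^ 2 + γ / 2 * q := by
  refine abs_le_of_sq_le_sq ?_ (by positivity)
  have h1 : (2 * s / γ * a ^ 2 + γ / 2 * q) ^ 2 =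
      (2 * s / γ * a ^ 2 - γ / 2 * q) ^ 2 + 4 * a ^ 2 * (s * q) := by
    field_simp
    ring
  rw [h1]
  nlinarith [sq_nonneg (2 * s / γ * a ^ 2 - γ / 2 * q), sq_nonneg a]

/-- Either `ρ ≤ γ/4`, or `2ρ ≤ 2ρ(4ρ/γ)⁵`, and `2048 = 2·4⁵`. -/
theorem two_mul_le_pow_six_add {ρ γ : ℝ} (hγ : 0 < γ) (hρ : 0 ≤ ρ) :
    2 * ρ ≤ 2048 * ρ ^ 6 / γ ^ 5 + γ / 2 := by
  rcases le_total ρ (γ / 4) with h | h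
  · have : 0 ≤ 2048 * ρ ^ 6 / γ ^ 5 := by positivity
    linarith
  · have h1 : (γ / 4) ^ 5 ≤ ρ ^ 5 := pow_le_pow_left₀ (by positivity) h 5
    have h2 : 2 * ρ ≤ 2048 * ρ ^ 6 / γ ^ 5 := by
      rw [le_div_iff₀ (by positivity)]
      nlinarith
    linarith

/-- Second-order perturbation of an isolated eigenvalue, with an error term in which the norm of
the perturbation enters only to the sixth power. -/
theorem exists_abs_orderedEigenvalue_add_sub_le {n : ℕ} {D : Matrix (Fin n) (Fin n) ℝ}
    (hD : D.IsHermitian) {i : ℕ} (hi : i < n) {γ : ℝ} (hγ : 0 < γ)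
    (hlow : ∀ j < i, orderedEigenvalue hD i + γ ≤ orderedEigenvalue hD j)
    (hup : ∀ j < n, i < j → orderedEigenvalue hD j ≤ orderedEigenvalue hD i - γ) :
    ∃ v : Fin n → ℝ, v ⬝ᵥ v = 1 ∧ ∀ (W : Matrix (Fin n) (Fin n) ℝ) (_ : W.IsHermitian)
      (hDW : (W + D).IsHermitian),
      |orderedEigenvalue hDW i - orderedEigenvalue hD i - v ⬝ᵥ W *ᵥ v| ≤
        2 / γ * (W *ᵥ v ⬝ᵥ W *ᵥ v) + 2048 / γ ^ 5 * ∑ a, ∑ b, (W ^ 3) a b ^ 2 := by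
  obtain ⟨u, ho, he, hb⟩ := exists_eigenbasis hD
  set v := u ⟨i, hi⟩ with hv
  have hvv : v ⬝ᵥ v = 1 := by simp [hv, ho]
  refine ⟨v, hvv, fun W hW hDW => ?_⟩
  set F := ∑ a, ∑ b, (W ^ 3) a b ^ 2 with hF
  have hF0 : 0 ≤ F := by positivity
  -- `F` is `tr(W⁶)`, so `ρ` dominates the operator norm of `W` while `ρ⁶` remains a polynomial in
  -- the entries.
  obtain ⟨ρ, hρ, hρ6⟩ : ∃ ρ : ℝ, 0 ≤ ρ ∧ F = ρ ^ 6 :=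
    ⟨F ^ (6⁻¹ : ℝ), by positivity, by
      rw [← Real.rpow_natCast, ← Real.rpow_mul hF0]; norm_num⟩
  have hWρ := abs_dotProduct_mulVec_le_of_pow_six hW hρ hρ6
  set lam := orderedEigenvalue hD i with hlam
  set s := W *ᵥ v ⬝ᵥ W *ᵥ v with hs
  set w := v ⬝ᵥ W *ᵥ v with hw
  have hs0 : 0 ≤ s := dotProduct_self_nonneg' _
  have hw' : |w| ≤ ρ := by simpa [hvv] using hWρ v
  have hR : 2 / γ * s + 2048 / γ ^ 5 * F = 2 * s / γ + 2048 * ρ ^ 6 / γ ^ 5 := by rw [hρ6]; ring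
  have hρ2 := two_mul_le_pow_six_add hγ hρ
  have hT : 0 ≤ 2048 * ρ ^ 6 / γ ^ 5 := by positivity
  have hS : 0 ≤ 2 * s / γ := by positivity
  -- Split `x = a v + z` with `z ⟂ v`: `q = |z|²`, `d` is the form of `D` at `z`, and `c = Wv·z`.
  -- The forms of `D` do not mix `v` and `z`, so the only cross term is `2ac`.
  have decomp : ∀ x, ∃ a c q d : ℝ, ∃ z, z ⬝ᵥ z = q ∧ (v ⬝ᵥ z = 0) ∧
      (∀ j, j ≠ ⟨i, hi⟩ → u j ⬝ᵥ z = u j ⬝ᵥ x) ∧ z ⬝ᵥ D *ᵥ z = d ∧ 0 ≤ q ∧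
      x ⬝ᵥ x = a ^ 2 + q ∧ |2 * a * c| ≤ 2 * s / γ * a ^ 2 + γ / 2 * q ∧
      |z ⬝ᵥ W *ᵥ z| ≤ ρ * q ∧
      x ⬝ᵥ (W + D) *ᵥ x = lam * a ^ 2 + d + w * a ^ 2 + 2 * a * c + z ⬝ᵥ W *ᵥ z := by
    intro x
    set a := v ⬝ᵥ x with ha
    set z := x - a • v with hz
    have hvz : v ⬝ᵥ z = 0 := by
      rw [hz, dotProduct_sub, dotProduct_smul, hvv, smul_eq_mul, mul_one, ha, sub_self]
    have hzv : z ⬝ᵥ v = 0 := by rw [dotProduct_comm, hvz]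
    have hx : x = a • v + z := by rw [hz]; abel
    have hDv : D *ᵥ v = lam • v := he ⟨i, hi⟩
    refine ⟨a, W *ᵥ v ⬝ᵥ z, _, _, z, rfl, hvz, fun j hj => ?_, rfl, dotProduct_self_nonneg' _,
      ?_, ?_, hWρ z, ?_⟩
    · rw [hz, dotProduct_sub, dotProduct_smul, hv, ho, if_neg hj, smul_zero, sub_zero]
    · conv_lhs => rw [hx]
      simp only [dotProduct_add, add_dotProduct, smul_dotProduct, dotProduct_smul, hvv, hvz, hzv,
        smul_eq_mul]
      ring
    · exact two_mul_le_of_sq_le hγ hs0 (dotProduct_self_nonneg' _) (dotProduct_sq_le _ _)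
    · have h1 : z ⬝ᵥ W *ᵥ v = W *ᵥ v ⬝ᵥ z := dotProduct_comm _ _
      have h2 : v ⬝ᵥ W *ᵥ z = W *ᵥ v ⬝ᵥ z := dotProduct_mulVec_comm hW _ _
      have h3 : z ⬝ᵥ D *ᵥ v = 0 := by rw [hDv, dotProduct_smul, hzv, smul_zero]
      have h4 : v ⬝ᵥ D *ᵥ z = 0 := by
        rw [dotProduct_mulVec_comm hD, hDv, smul_dotProduct, hvz, smul_zero]
      have h5 : v ⬝ᵥ D *ᵥ v = lam := by rw [hDv, dotProduct_smul, hvv, smul_eq_mul, mul_one]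
      conv_lhs => rw [hx]
      simp only [add_mulVec, mulVec_add, mulVec_smul, dotProduct_add, add_dotProduct,
        smul_dotProduct, dotProduct_smul, h1, h2, h3, h4, h5, ← hw, smul_eq_mul]
      ring
  rw [hR, abs_le]
  constructor
  · have : lam + w - (2 * s / γ + 2048 * ρ ^ 6 / γ ^ 5) ≤ orderedEigenvalue hDW i := by
      -- On the span of `u_0, …, u_i` the vector `z` only involves eigenvalues at least `lam + γ`.
      refine le_orderedEigenvalue hDW (fun j : {j : Fin n // ⟨i, hi⟩ < j} => u j) (by
        rw [Fintype.card_subtype, Finset.filter_lt_eq_Ioi, Fin.card_Ioi]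
        simp only
        omega) fun x hx => ?_
      obtain ⟨a, c, q, d, z, hzq, hvz, huz, hd, hq, hxx, hac, hzz, hquad⟩ := decomp x
      have hdle : (lam + γ) * q ≤ d := by
        rw [← hd, ← hzq, dotProduct_mulVec_eq_sum_of_eigenbasis hD hb he,
          dotProduct_eq_sum_of_eigenbasis hb, Finset.mul_sum]
        refine Finset.sum_le_sum fun j _ => ?_
        rcases lt_trichotomy j ⟨i, hi⟩ with hj | hj | hj
        · rw [← sq]
          exact mul_le_mul_of_nonneg_right (hlow j hj) (sq_nonneg _)
        · rw [hj, ← hv, hvz]; simp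
        · rw [huz j hj.ne', hx ⟨j, hj⟩]; simp
      rw [hquad, hxx]
      have h1 := (abs_le.1 hac).1
      have h2 := (abs_le.1 hzz).1
      have h3 := mul_le_mul_of_nonneg_right (abs_le.1 hw').2 hq
      -- Half of the gap is left after the cross term. It must absorb `ρ` twice, from `z'Wz` and
      -- from comparing with `w q`; hence the bound on `2ρ`.
      have h4 := mul_le_mul_of_nonneg_right hρ2 hq
      have h5 := mul_nonneg hT (sq_nonneg a)
      have h6 := mul_nonneg hS hq
      linarith
    linarith
  · have : orderedEigenvalue hDW i ≤ lam + w + (2 * s / γ + 2048 * ρ ^ 6 / γ ^ 5) := by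
      refine orderedEigenvalue_le hDW hi (fun j : {j : Fin n // j < ⟨i, hi⟩} => u j) (by
        rw [Fintype.card_subtype, Finset.filter_gt_eq_Iio, Fin.card_Iio]) fun x hx => ?_
      obtain ⟨a, c, q, d, z, hzq, hvz, huz, hd, hq, hxx, hac, hzz, hquad⟩ := decomp x
      have hdle : d ≤ (lam - γ) * q := by
        rw [← hd, ← hzq, dotProduct_mulVec_eq_sum_of_eigenbasis hD hb he,
          dotProduct_eq_sum_of_eigenbasis hb, Finset.mul_sum]
        refine Finset.sum_le_sum fun j _ => ?_
        rcases lt_trichotomy j ⟨i, hi⟩ with hj | hj | hj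
        · rw [huz j hj.ne, hx ⟨j, hj⟩]; simp
        · rw [hj, ← hv, hvz]; simp
        · rw [← sq]
          exact mul_le_mul_of_nonneg_right (hup j j.2 hj) (sq_nonneg _)
      rw [hquad, hxx]
      have h1 := (abs_le.1 hac).2
      have h2 := (abs_le.1 hzz).2
      have h3 := mul_le_mul_of_nonneg_right (abs_le.1 hw').1 hq
      have h4 := mul_le_mul_of_nonneg_right hρ2 hq
      have h5 := mul_nonneg hT (sq_nonneg a)
      have h6 := mul_nonneg hS hq
      linarith
    linarith

/-! ### Closed walks of length six and the expansion of `tr(W⁶)`. -/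

/-- The unordered pair `{a, b}`, as an index of the upper triangle of a matrix. -/
def edge {N : ℕ} (a b : Fin N) : {p : Fin N × Fin N // p.1 ≤ p.2} :=
  ⟨(min a b, max a b), min_le_max⟩

theorem eq_or_eq_of_edge_eq {N : ℕ} {a b c d : Fin N} (h : edge a b = edge c d) :
    b = c ∨ b = d := by
  simp only [edge, Subtype.mk.injEq, Prod.mk.injEq] at h
  rcases le_total a b with h1 | h1 <;> rcases le_total c d with h2 | h2 <;>
    simp only [min_eq_left, max_eq_right, min_eq_right, max_eq_left, h1, h2] at h <;>
    simp [h.1, h.2]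

theorem eq_of_edge_eq {N : ℕ} {a b c : Fin N} (h : edge a b = edge a c) : b = c := by
  rcases eq_or_eq_of_edge_eq h with h1 | h1
  · rcases eq_or_eq_of_edge_eq h.symm with h2 | h2
    · rw [h1, h2]
    · exact h2.symm
  · exact h1

/-- A walk visits at most one vertex more than the number of edges that it uses. -/
theorem card_image_vertices_le {N : ℕ} (w : ℕ → Fin N) (m : ℕ) :
    ((Finset.range (m + 1)).image w).card ≤
      ((Finset.range m).image fun t => edge (w t) (w (t + 1))).card + 1 := by
  induction m with
  | zero => simp
  | succ m ih =>
    by_cases hw : w (m + 1) ∈ (Finset.range (m + 1)).image w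
    · rw [Finset.range_add_one, Finset.image_insert, Finset.insert_eq_of_mem hw]
      refine ih.trans ?_
      gcongr
      omega
    · have he : edge (w m) (w (m + 1)) ∉
          (Finset.range m).image fun t => edge (w t) (w (t + 1)) := fun he => by
        obtain ⟨t, ht, hte⟩ := Finset.mem_image.1 he
        rw [Finset.mem_range] at ht
        rcases eq_or_eq_of_edge_eq hte.symm with h | h
        · exact hw (Finset.mem_image.2 ⟨t, Finset.mem_range.2 (by omega), h.symm⟩)
        · exact hw (Finset.mem_image.2 ⟨t + 1, Finset.mem_range.2 (by omega), h.symm⟩)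
      have h1 : Finset.range (m + 1 + 1) = insert (m + 1) (Finset.range (m + 1)) :=
        Finset.range_add_one
      have h2 : Finset.range (m + 1) = insert m (Finset.range m) := Finset.range_add_one
      rw [h1, Finset.image_insert, Finset.card_insert_of_notMem hw]
      conv_rhs => rw [h2, Finset.image_insert, Finset.card_insert_of_notMem he]
      exact Nat.succ_le_succ ih

/-- A closed walk of length six that uses no edge exactly once has at most four vertices. -/
theorem card_image_closed_walk_le {N : ℕ} (w : Fin 6 → Fin N)
    (hw : ∀ t, ∃ s, s ≠ t ∧ edge (w s) (w (s + 1)) = edge (w t) (w (t + 1))) :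
    (Finset.univ.image w).card ≤ 4 := by
  have h1 : 2 * (Finset.univ.image fun t => edge (w t) (w (t + 1))).card ≤ 6 := by
    refine (Finset.mul_card_image_le_card Finset.univ 2 fun p hp => ?_).trans (by simp)
    obtain ⟨t, -, rfl⟩ := Finset.mem_image.1 hp
    obtain ⟨s, hs, hst⟩ := hw t
    exact Finset.one_lt_card.2 ⟨s, by simpa using hst, t, by simp, hs⟩
  -- Five steps already visit all six positions; the closing step adds no vertex. At most three
  -- distinct edges then give at most four vertices.
  have h2 := card_image_vertices_le (fun n => w (Fin.ofNat 6 n)) 5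
  norm_num only at h2
  have h3 : Finset.univ.image w ⊆ (Finset.range 6).image fun n => w (Fin.ofNat 6 n) := by
    intro v hv
    obtain ⟨t, -, rfl⟩ := Finset.mem_image.1 hv
    exact Finset.mem_image.2 ⟨t, Finset.mem_range.2 t.2, by simp⟩
  have h4 : ((Finset.range 5).image fun t : ℕ =>
      edge (w (Fin.ofNat 6 t)) (w (Fin.ofNat 6 (t + 1)))) ⊆
      Finset.univ.image fun t => edge (w t) (w (t + 1)) := by
    intro p hp
    obtain ⟨t, -, rfl⟩ := Finset.mem_image.1 hp
    refine Finset.mem_image.2 ⟨Fin.ofNat 6 t, Finset.mem_univ _, ?_⟩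
    congr 2
    ext
    simp [Fin.val_add]
  have h5 := Finset.card_le_card h3
  have h6 := Finset.card_le_card h4
  omega

/-- A walk with at most `r` vertices factors as a map into `r` labels followed by an assignment of
vertices to labels; unused labels go to `w 0`. -/
theorem card_filter_card_image_le (N m r : ℕ) [NeZero m] :
    (Finset.univ.filter fun w : Fin m → Fin N => (Finset.univ.image w).card ≤ r).card ≤
      N ^ r * r ^ m := by
  classical
  have hsub : (Finset.univ.filter fun w : Fin m → Fin N => (Finset.univ.image w).card ≤ r) ⊆
      Finset.univ.image fun gφ : (Fin r → Fin N) × (Fin m → Fin r) => gφ.1 ∘ gφ.2 := by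
    intro w hw
    obtain ⟨ι⟩ : Nonempty ((Finset.univ.image w) ↪ Fin r) :=
      Function.Embedding.nonempty_of_card_le
        (by rw [Fintype.card_coe, Fintype.card_fin]; exact (Finset.mem_filter.1 hw).2)
    refine Finset.mem_image.2 ⟨(Function.extend ι Subtype.val fun _ => w 0,
      fun t => ι ⟨w t, Finset.mem_image_of_mem _ (Finset.mem_univ _)⟩), Finset.mem_univ _, ?_⟩
    funext t
    change Function.extend ι Subtype.val (fun _ => w 0) (ι _) = w t
    rw [ι.injective.extend_apply]
  refine (Finset.card_le_card hsub).trans (Finset.card_image_le.trans ?_)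
  simp

theorem sum_fin_succ_fun {α : Type*} [Fintype α] {n : ℕ} (F : (Fin (n + 1) → α) → ℝ) :
    ∑ w, F w = ∑ a, ∑ w, F (Fin.cons a w) := by
  rw [← (Fin.consEquiv fun _ : Fin (n + 1) => α).sum_comp, Fintype.sum_prod_type]
  rfl

theorem sum_sq_pow_three_eq {N : ℕ} {W : Matrix (Fin N) (Fin N) ℝ} (hW : W.IsHermitian) :
    ∑ a, ∑ b, (W ^ 3) a b ^ 2 = ∑ w : Fin 6 → Fin N, ∏ t, W (w t) (w (t + 1)) := by
  have h3 : ∀ a b, (W ^ 3) a b = (W ^ 3) b a := fun a b => by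
    simpa using (hW.pow 3).apply b a
  have h6 : ∀ a, ∑ b, (W ^ 3) a b ^ 2 = (W * (W * (W * (W * (W * W))))) a a := fun a => by
    have : W * (W * (W * (W * (W * W)))) = W ^ 3 * W ^ 3 := by
      simp only [pow_succ, pow_zero, one_mul, mul_assoc]
    rw [this, mul_apply]
    exact Finset.sum_congr rfl fun b _ => by rw [sq, ← h3 a b]
  simp only [h6, sum_fin_succ_fun, mul_apply, Finset.mul_sum, Fin.prod_univ_succ]
  simp
  rfl

/-! ### Moments of the random matrix. -/

section Moments

set_option linter.unusedSectionVars false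

variable {N : ℕ} {Ω : Type*} [MeasurableSpace Ω] {P : Measure Ω} [IsProbabilityMeasure P]
  {X : Fin N → Fin N → Ω → ℝ} {f : ℝ → ℝ → ℝ} {B : ℝ}

/-- The value of the upper triangle of the array at an unordered pair. -/
def entry (X : Fin N → Fin N → Ω → ℝ) (p : {p : Fin N × Fin N // p.1 ≤ p.2}) : Ω → ℝ :=
  X p.1.1 p.1.2

/-- A bound for the absolute moments of the entries up to the sixth. -/
noncomputable def momentBound (B : ℝ) : ℝ := (6 : ℝ) ^ (B * 6)

theorem one_le_momentBound (hB : 0 < B) : 1 ≤ momentBound B :=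
  Real.one_le_rpow (by norm_num) (by positivity)

theorem symmMatrix_apply (a b : Fin N) (ω : Ω) :
    symmMatrix (fun a b => X a b ω) a b = entry X (edge a b) ω := rfl

theorem IsWignerArray.measurable_entry (hX : IsWignerArray P X f B)
    (p : {p : Fin N × Fin N // p.1 ≤ p.2}) : Measurable (entry X p) :=
  hX.measurable _ _ p.2

theorem IsWignerArray.integrable_pow_entry (hX : IsWignerArray P X f B)
    (p : {p : Fin N × Fin N // p.1 ≤ p.2}) (m : ℕ) :
    Integrable (fun ω => |entry X p ω| ^ m) P := by
  rcases Nat.eq_zero_or_pos m with rfl | hm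
  · simp
  · exact (hX.moment _ _ p.2 m hm).1

/-- The bound is stated as an `m`-th power, weaker than needed for one entry, so that bounds
multiply over distinct edges to a power of the total number of factors. -/
theorem IsWignerArray.abs_integral_pow_entry_le (hX : IsWignerArray P X f B) (hB : 0 < B)
    (p : {p : Fin N × Fin N // p.1 ≤ p.2}) {m : ℕ} (hm6 : m ≤ 6) :
    |∫ ω, entry X p ω ^ m ∂P| ≤ momentBound B ^ m := by
  rcases Nat.eq_zero_or_pos m with rfl | hm
  · simp
  · have h1 : (1 : ℝ) ≤ m := by exact_mod_cast hm
    have h6 : (m : ℝ) ≤ 6 := by exact_mod_cast hm6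
    calc |∫ ω, entry X p ω ^ m ∂P| ≤ ∫ ω, |entry X p ω| ^ m ∂P := by
          simpa only [abs_pow] using abs_integral_le_integral_abs (f := fun ω => entry X p ω ^ m)
      _ ≤ (m : ℝ) ^ (B * (m : ℝ)) := (hX.moment _ _ p.2 m hm).2
      _ ≤ (6 : ℝ) ^ (B * (m : ℝ)) := Real.rpow_le_rpow (by positivity) h6 (by positivity)
      _ ≤ momentBound B := Real.rpow_le_rpow_of_exponent_le (by norm_num) (by gcongr)
      _ ≤ momentBound B ^ m := le_self_pow₀ (one_le_momentBound hB) hm.ne'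

theorem abs_prod_le_sum_pow {m : ℕ} (hm : m ≠ 0) (y : Fin m → ℝ) :
    |∏ t, y t| ≤ ∑ t, |y t| ^ m := by
  have : NeZero m := ⟨hm⟩
  obtain ⟨s, -, hs⟩ := Finset.exists_max_image Finset.univ (fun t => |y t|) ⟨0, Finset.mem_univ _⟩
  rw [Finset.abs_prod]
  calc ∏ t, |y t| ≤ ∏ _t : Fin m, |y s| :=
        Finset.prod_le_prod (fun _ _ => abs_nonneg _) fun t ht => hs t ht
    _ = |y s| ^ m := by simp
    _ ≤ _ := Finset.single_le_sum (f := fun t => |y t| ^ m) (fun _ _ => by positivity)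
        (Finset.mem_univ s)

theorem IsWignerArray.integrable_prod_entry (hX : IsWignerArray P X f B) {m : ℕ} (hm : m ≠ 0)
    (e : Fin m → {p : Fin N × Fin N // p.1 ≤ p.2}) :
    Integrable (fun ω => ∏ t, entry X (e t) ω) P := by
  refine Integrable.mono' (integrable_finsetSum Finset.univ fun t _ =>
    hX.integrable_pow_entry (e t) m) ?_ (Eventually.of_forall fun ω => ?_)
  · exact (Finset.measurable_prod _ fun t _ => hX.measurable_entry (e t)).aestronglyMeasurable
  · exact abs_prod_le_sum_pow hm _

/-- Grouping equal edges lets independence factor the expectation over all pairs; unused pairs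
contribute `1`. -/
theorem IsWignerArray.integral_prod_entry (hX : IsWignerArray P X f B) {m : ℕ}
    (e : Fin m → {p : Fin N × Fin N // p.1 ≤ p.2}) :
    ∫ ω, ∏ t, entry X (e t) ω ∂P =
      ∏ p, ∫ ω, entry X p ω ^ (Finset.univ.filter fun t => e t = p).card ∂P := by
  have h := hX.indep.integral_fun_prod_comp (𝕜 := ℝ)
    (f := fun p y => y ^ (Finset.univ.filter fun t => e t = p).card)
    (fun p => (hX.measurable_entry p).aemeasurable)
    (fun p => (continuous_pow _).aestronglyMeasurable)
  refine Eq.trans (integral_congr_ae (Eventually.of_forall fun ω => ?_)) h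
  simp only
  rw [← Finset.prod_fiberwise' Finset.univ e fun p => entry X p ω]
  simp only [Finset.prod_const]
  rfl

theorem IsWignerArray.abs_integral_prod_entry_le (hX : IsWignerArray P X f B) (hB : 0 < B)
    {m : ℕ} (hm : m ≤ 6) (e : Fin m → {p : Fin N × Fin N // p.1 ≤ p.2}) :
    |∫ ω, ∏ t, entry X (e t) ω ∂P| ≤ momentBound B ^ m := by
  have hcard : ∑ p, (Finset.univ.filter fun t => e t = p).card = m := by
    simpa using (Finset.card_eq_sum_card_fiberwise (f := e) (s := Finset.univ) (t := Finset.univ)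
      fun _ _ => Finset.mem_coe.2 (Finset.mem_univ _)).symm
  rw [hX.integral_prod_entry, Finset.abs_prod]
  refine (Finset.prod_le_prod (fun _ _ => abs_nonneg _) fun p _ =>
    hX.abs_integral_pow_entry_le hB p ?_).trans ?_
  · exact ((Finset.card_le_univ _).trans (by simp)).trans hm
  · rw [Finset.prod_pow_eq_pow_sum, hcard]

/-- An edge used exactly once contributes the factor `E X = 0`. -/
theorem IsWignerArray.integral_prod_entry_eq_zero (hX : IsWignerArray P X f B) {m : ℕ}
    (e : Fin m → {p : Fin N × Fin N // p.1 ≤ p.2}) (t : Fin m) (ht : ∀ s, s ≠ t → e s ≠ e t) :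
    ∫ ω, ∏ t, entry X (e t) ω ∂P = 0 := by
  rw [hX.integral_prod_entry]
  refine Finset.prod_eq_zero (Finset.mem_univ (e t)) ?_
  have : (Finset.univ.filter fun s => e s = e t) = {t} := by
    ext s
    simp only [Finset.mem_filter, Finset.mem_univ, true_and, Finset.mem_singleton]
    exact ⟨fun h => by_contra fun hs => ht s hs h, fun h => by rw [h]⟩
  rw [this]
  simp only [Finset.card_singleton, pow_one]
  exact hX.mean_zero _ _ (e t).2

theorem IsWignerArray.integrable_sum_sq_pow_three (hX : IsWignerArray P X f B) :
    Integrable (fun ω => ∑ a, ∑ b, ((symmMatrix fun a b => X a b ω) ^ 3) a b ^ 2) P := by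
  simp only [fun ω => sum_sq_pow_three_eq (symmMatrix_isHermitian fun a b => X a b ω),
    symmMatrix_apply]
  exact integrable_finsetSum _ fun w _ =>
    hX.integrable_prod_entry (by norm_num) fun t => edge (w t) (w (t + 1))

/-- Only walks repeating every edge have nonzero expectation. They have at most four vertices, so
there are at most `4⁶ N⁴` of them. -/
theorem IsWignerArray.integral_sum_sq_pow_three_le (hX : IsWignerArray P X f B) (hB : 0 < B) :
    ∫ ω, ∑ a, ∑ b, ((symmMatrix fun a b => X a b ω) ^ 3) a b ^ 2 ∂P ≤
      4 ^ 6 * momentBound B ^ 6 * (N : ℝ) ^ 4 := by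
  classical
  have hK : 0 ≤ momentBound B ^ 6 := by have := one_le_momentBound hB; positivity
  have hsum : ∫ ω, ∑ a, ∑ b, ((symmMatrix fun a b => X a b ω) ^ 3) a b ^ 2 ∂P =
      ∑ w : Fin 6 → Fin N, ∫ ω, ∏ t, entry X (edge (w t) (w (t + 1))) ω ∂P := by
    have hi : ∀ w ∈ (Finset.univ : Finset (Fin 6 → Fin N)),
        Integrable (fun ω => ∏ t, entry X (edge (w t) (w (t + 1))) ω) P := fun w _ =>
      hX.integrable_prod_entry (by norm_num) fun t => edge (w t) (w (t + 1))
    refine Eq.trans ?_ (integral_finsetSum Finset.univ hi)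
    exact integral_congr_ae (Eventually.of_forall fun ω =>
      sum_sq_pow_three_eq (symmMatrix_isHermitian fun a b => X a b ω))
  rw [hsum]
  have hle : ∀ w : Fin 6 → Fin N, ∫ ω, ∏ t, entry X (edge (w t) (w (t + 1))) ω ∂P ≤
      if (Finset.univ.image w).card ≤ 4 then momentBound B ^ 6 else 0 := fun w => by
    split_ifs with hw
    · exact (le_abs_self _).trans (hX.abs_integral_prod_entry_le hB le_rfl _)
    · have := mt (card_image_closed_walk_le w) hw
      push Not at this
      obtain ⟨t, ht⟩ := this
      exact (hX.integral_prod_entry_eq_zero (fun t => edge (w t) (w (t + 1))) t ht).le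
  refine (Finset.sum_le_sum fun w _ => hle w).trans ?_
  rw [← Finset.sum_filter, Finset.sum_const, nsmul_eq_mul]
  have h1 : (_ : ℝ) ≤ _ := Nat.cast_le.2 (card_filter_card_image_le N 6 4)
  rw [Nat.cast_mul, Nat.cast_pow, Nat.cast_pow, Nat.cast_ofNat] at h1
  calc _ ≤ (N : ℝ) ^ 4 * 4 ^ 6 * momentBound B ^ 6 := mul_le_mul_of_nonneg_right h1 hK
    _ = _ := by ring

theorem mulVec_dotProduct_mulVec_eq (W : Matrix (Fin N) (Fin N) ℝ) (x : Fin N → ℝ) :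
    W *ᵥ x ⬝ᵥ W *ᵥ x = ∑ a, ∑ b, ∑ c, x b * x c * (W a b * W a c) := by
  simp only [dotProduct, mulVec, Finset.sum_mul, Finset.mul_sum]
  refine Finset.sum_congr rfl fun a _ => ?_
  rw [Finset.sum_comm]
  exact Finset.sum_congr rfl fun b _ => Finset.sum_congr rfl fun c _ => by ring

theorem IsWignerArray.integrable_entry_mul_entry (hX : IsWignerArray P X f B)
    (p q : {p : Fin N × Fin N // p.1 ≤ p.2}) :
    Integrable (fun ω => entry X p ω * entry X q ω) P := by
  simpa using hX.integrable_prod_entry two_ne_zero ![p, q]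

theorem IsWignerArray.integrable_mulVec_dotProduct_mulVec (hX : IsWignerArray P X f B)
    (x : Fin N → ℝ) :
    Integrable (fun ω => (symmMatrix fun a b => X a b ω) *ᵥ x ⬝ᵥ
      (symmMatrix fun a b => X a b ω) *ᵥ x) P := by
  simp only [mulVec_dotProduct_mulVec_eq, symmMatrix_apply]
  exact integrable_finsetSum _ fun a _ => integrable_finsetSum _ fun b _ =>
    integrable_finsetSum _ fun c _ => (hX.integrable_entry_mul_entry _ _).const_mul _

theorem IsWignerArray.integral_mulVec_dotProduct_mulVec_le (hX : IsWignerArray P X f B)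
    (hB : 0 < B) (x : Fin N → ℝ) :
    ∫ ω, (symmMatrix fun a b => X a b ω) *ᵥ x ⬝ᵥ (symmMatrix fun a b => X a b ω) *ᵥ x ∂P ≤
      momentBound B ^ 2 * N * (x ⬝ᵥ x) := by
  simp only [mulVec_dotProduct_mulVec_eq, symmMatrix_apply]
  have hi : ∀ a b c, Integrable (fun ω => x b * x c *
      (entry X (edge a b) ω * entry X (edge a c) ω)) P := fun a b c =>
    (hX.integrable_entry_mul_entry _ _).const_mul _
  rw [integral_finsetSum _ fun a _ => integrable_finsetSum _ fun b _ =>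
    integrable_finsetSum _ fun c _ => hi a b c]
  have hle : ∀ a, ∫ ω, ∑ b, ∑ c, x b * x c *
      (entry X (edge a b) ω * entry X (edge a c) ω) ∂P ≤ momentBound B ^ 2 * (x ⬝ᵥ x) := fun a => by
    rw [integral_finsetSum _ fun b _ => integrable_finsetSum _ fun c _ => hi a b c,
      dotProduct, Finset.mul_sum]
    refine Finset.sum_le_sum fun b _ => ?_
    -- Entries of one row in different columns are uncorrelated, so only `c = b` survives.
    rw [integral_finsetSum _ fun c _ => hi a b c, Finset.sum_eq_single b]
    · rw [integral_const_mul, mul_comm]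
      refine mul_le_mul_of_nonneg_right ?_ (mul_self_nonneg _)
      have := (le_abs_self _).trans
        (hX.abs_integral_prod_entry_le hB (by norm_num) ![edge a b, edge a b])
      simpa using this
    · intro c _ hcb
      rw [integral_const_mul]
      have := hX.integral_prod_entry_eq_zero ![edge a b, edge a c] 0 (by
        intro s hs
        have : s = 1 := Fin.eq_one_of_ne_zero s hs
        subst this
        exact fun h => hcb (eq_of_edge_eq h))
      simp only [Fin.prod_univ_two, cons_val_zero, cons_val_one] at this
      rw [this, mul_zero]
    · simp
  refine (Finset.sum_le_sum fun a _ => hle a).trans ?_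
  simp only [Finset.sum_const, Finset.card_univ, Fintype.card_fin, nsmul_eq_mul]
  exact (by ring : _ = _).le

theorem IsWignerArray.integrable_entry (hX : IsWignerArray P X f B)
    (p : {p : Fin N × Fin N // p.1 ≤ p.2}) : Integrable (entry X p) P := by
  simpa using hX.integrable_prod_entry one_ne_zero ![p]

theorem IsWignerArray.integrable_dotProduct_mulVec (hX : IsWignerArray P X f B)
    (x : Fin N → ℝ) :
    Integrable (fun ω => x ⬝ᵥ (symmMatrix fun a b => X a b ω) *ᵥ x) P := by
  simp only [dotProduct, mulVec, symmMatrix_apply]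
  exact integrable_finsetSum _ fun a _ => (integrable_finsetSum _ fun b _ =>
    (hX.integrable_entry _).mul_const _).const_mul _

theorem IsWignerArray.integral_dotProduct_mulVec (hX : IsWignerArray P X f B)
    (x : Fin N → ℝ) : ∫ ω, x ⬝ᵥ (symmMatrix fun a b => X a b ω) *ᵥ x ∂P = 0 := by
  have hi : ∀ a b, Integrable (fun ω => entry X (edge a b) ω * x b) P := fun a b =>
    (hX.integrable_entry _).mul_const _
  simp only [dotProduct, mulVec, symmMatrix_apply]
  rw [integral_finsetSum _ fun a _ => (integrable_finsetSum _ fun b _ => hi a b).const_mul _]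
  refine Finset.sum_eq_zero fun a _ => ?_
  rw [integral_const_mul, integral_finsetSum _ fun b _ => hi a b, Finset.sum_eq_zero, mul_zero]
  intro b _
  rw [integral_mul_const, show ∫ ω, entry X (edge a b) ω ∂P = 0 from
    hX.mean_zero _ _ (edge a b).2, zero_mul]

/-- By symmetry `x'W²y = Wx·Wy`, which is at most `|Wx|² + |Wy|²` in absolute value. -/
theorem IsWignerArray.abs_integral_dotProduct_sq_mulVec_le (hX : IsWignerArray P X f B)
    (hB : 0 < B) (x y : Fin N → ℝ) :
    |∫ ω, x ⬝ᵥ (symmMatrix fun a b => X a b ω) ^ 2 *ᵥ y ∂P| ≤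
      momentBound B ^ 2 * N * (x ⬝ᵥ x + y ⬝ᵥ y) := by
  have hx := hX.integrable_mulVec_dotProduct_mulVec x
  have hy := hX.integrable_mulVec_dotProduct_mulVec y
  refine abs_integral_le_integral_abs.trans ?_
  refine (integral_mono_of_nonneg (Eventually.of_forall fun _ => abs_nonneg _) (hx.add hy)
    (Eventually.of_forall fun ω => ?_)).trans ?_
  · simp only [Pi.add_apply]
    have hW := symmMatrix_isHermitian fun a b => X a b ω
    set W := symmMatrix fun a b => X a b ω
    rw [sq, ← mulVec_mulVec, dotProduct_mulVec_comm hW]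
    have h1 := dotProduct_sq_le (W *ᵥ x) (W *ᵥ y)
    have h2 := dotProduct_self_nonneg' (W *ᵥ x)
    have h3 := dotProduct_self_nonneg' (W *ᵥ y)
    exact abs_le_of_sq_le_sq (by nlinarith) (by linarith)
  · simp only [Pi.add_apply]
    rw [integral_add hx hy, mul_add]
    exact add_le_add (hX.integral_mulVec_dotProduct_mulVec_le hB x)
      (hX.integral_mulVec_dotProduct_mulVec_le hB y)

end Moments

/-! ### Measurability and integrability of the eigenvalues. -/

open Topology

theorem continuous_orderedEigenvalue {n : ℕ} (i : ℕ) :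
    Continuous fun A : {A : Fin n → Fin n → ℝ // (Matrix.of A).IsHermitian} =>
      orderedEigenvalue A.2 i := by
  refine continuous_iff_continuousAt.2 fun A => ?_
  have hc : Continuous fun A' : {A : Fin n → Fin n → ℝ // (Matrix.of A).IsHermitian} =>
      ∑ j, ∑ l, |A'.1 j l - A.1 j l| :=
    continuous_finsetSum _ fun j _ => continuous_finsetSum _ fun l _ =>
      (((continuous_apply_apply j l).comp continuous_subtype_val).sub continuous_const).abs
  have h0 := hc.tendsto A
  simp only [sub_self, abs_zero, Finset.sum_const_zero] at h0
  exact tendsto_iff_norm_sub_tendsto_zero.2 <| squeeze_zero (fun _ => norm_nonneg _)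
    (fun A' => abs_orderedEigenvalue_sub_le A'.2 A.2 i) h0

/-- `orderedEigenvalue` takes a proof of symmetry, so measurability passes through the subtype of
symmetric matrices, on which it is continuous. -/
theorem measurable_subtype_isHermitian {n : ℕ} {Ω : Type*} [MeasurableSpace Ω]
    {M : Ω → Fin n → Fin n → ℝ} (hM : ∀ ω, (Matrix.of (M ω)).IsHermitian)
    (hm : ∀ a b, Measurable fun ω => M ω a b) :
    Measurable fun ω =>
      (⟨M ω, hM ω⟩ : {A : Fin n → Fin n → ℝ // (Matrix.of A).IsHermitian}) := by
  have : Measurable M := measurable_pi_lambda _ fun a => measurable_pi_lambda _ fun b => hm a b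
  exact this.subtype_mk

theorem measurable_orderedEigenvalue {n : ℕ} {Ω : Type*} [MeasurableSpace Ω]
    {M : Ω → Matrix (Fin n) (Fin n) ℝ} (hM : ∀ ω, (M ω).IsHermitian)
    (hm : ∀ a b, Measurable fun ω => M ω a b) (i : ℕ) :
    Measurable fun ω => orderedEigenvalue (hM ω) i := by
  have h1 : Measurable fun A : {A : Fin n → Fin n → ℝ // (Matrix.of A).IsHermitian} =>
      orderedEigenvalue A.2 i := (continuous_orderedEigenvalue i).measurable
  have h2 := measurable_subtype_isHermitian (M := M) hM hm
  generalize hg : (fun A : {A : Fin n → Fin n → ℝ // (Matrix.of A).IsHermitian} =>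
      orderedEigenvalue A.2 i) = g at h1
  have : (fun ω => orderedEigenvalue (hM ω) i) = fun ω => g ⟨M ω, hM ω⟩ := by
    funext ω
    rw [← hg]
    rfl
  rw [this]
  exact h1.comp h2

theorem integrable_orderedEigenvalue {n : ℕ} {Ω : Type*} [MeasurableSpace Ω] {P : Measure Ω}
    [IsFiniteMeasure P] {M : Ω → Matrix (Fin n) (Fin n) ℝ} (hM : ∀ ω, (M ω).IsHermitian)
    (hm : ∀ a b, Measurable fun ω => M ω a b) (hi : ∀ a b, Integrable (fun ω => M ω a b) P)
    (i : ℕ) : Integrable (fun ω => orderedEigenvalue (hM ω) i) P := by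
  have h0 : (0 : Matrix (Fin n) (Fin n) ℝ).IsHermitian := isHermitian_zero
  refine Integrable.mono' ((integrable_finsetSum Finset.univ fun a _ =>
    integrable_finsetSum Finset.univ fun b _ => (hi a b).abs).add
      (integrable_const |orderedEigenvalue h0 i|))
    (measurable_orderedEigenvalue hM hm i).aestronglyMeasurable
    (Eventually.of_forall fun ω => ?_)
  have := abs_orderedEigenvalue_sub_le (hM ω) h0 i
  simp only [Matrix.zero_apply, sub_zero] at this
  rw [Real.norm_eq_abs]
  simp only [Pi.add_apply]
  calc |orderedEigenvalue (hM ω) i| =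
        |orderedEigenvalue (hM ω) i - orderedEigenvalue h0 i + orderedEigenvalue h0 i| := by
          rw [sub_add_cancel]
    _ ≤ _ := (abs_add_le _ _).trans (add_le_add_left this _)

/-! ### The deterministic part, and the comparison of both sides with its eigenvalue. -/

/-- The matrix with columns `√(θ α_j) e_j`. -/
noncomputable def spikeMatrix {k : ℕ} (N : ℕ) (θ : ℝ) (α : Fin k → ℝ) (h : Fin k → ℝ → ℝ) :
    Matrix (Fin N) (Fin k) ℝ :=
  Matrix.of fun a j => Real.sqrt (θ * α j) * discretize N (h j) a

section Spike

variable {k N : ℕ} {θ : ℝ} {α : Fin k → ℝ} {h : Fin k → ℝ → ℝ}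

theorem spikeMatrix_mul_transpose (hθ : 0 ≤ θ) (hα : ∀ j, 0 < α j) :
    θ • ∑ i, α i • Matrix.vecMulVec (discretize N (h i)) (discretize N (h i)) =
      spikeMatrix N θ α h * (spikeMatrix N θ α h)ᵀ := by
  ext a b
  simp only [Matrix.smul_apply, Matrix.sum_apply, vecMulVec_apply, mul_apply, transpose_apply, spikeMatrix,
    of_apply, smul_eq_mul, Finset.mul_sum]
  refine Finset.sum_congr rfl fun j _ => ?_
  have := Real.mul_self_sqrt (mul_nonneg hθ (hα j).le)
  linear_combination (-(discretize N (h j) a * discretize N (h j) b)) * this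

theorem transpose_mul_spikeMatrix_apply (hθ : 0 ≤ θ) (hα : ∀ j, 0 < α j) (j l : Fin k) :
    ((spikeMatrix N θ α h)ᵀ * spikeMatrix N θ α h) j l =
      Real.sqrt (α j * α l) * θ * (discretize N (h j) ⬝ᵥ discretize N (h l)) := by
  simp only [mul_apply, transpose_apply, spikeMatrix, of_apply, dotProduct, Finset.mul_sum]
  refine Finset.sum_congr rfl fun a _ => ?_
  rw [Real.sqrt_mul hθ, Real.sqrt_mul hθ, Real.sqrt_mul (hα j).le]
  linear_combination (Real.sqrt (α j) * Real.sqrt (α l) * discretize N (h j) a *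
    discretize N (h l) a) * Real.mul_self_sqrt hθ

theorem isHermitian_spikeMatrix_mul_transpose :
    (spikeMatrix N θ α h * (spikeMatrix N θ α h)ᵀ).IsHermitian := by
  simpa using isHermitian_mul_conjTranspose_self (spikeMatrix N θ α h)

theorem isHermitian_transpose_mul_spikeMatrix :
    ((spikeMatrix N θ α h)ᵀ * spikeMatrix N θ α h).IsHermitian := by
  simpa using isHermitian_conjTranspose_mul_self (spikeMatrix N θ α h)

/-- The distance of the scaled Gram matrix of the discretized signals to its limit. -/
noncomputable def gramError {k : ℕ} (N : ℕ) (α : Fin k → ℝ) (h : Fin k → ℝ → ℝ) : ℝ :=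
  ∑ j, ∑ l, |Real.sqrt (α j * α l) * (discretize N (h j) ⬝ᵥ discretize N (h l)) -
    Matrix.diagonal α j l|

theorem OrthonormalSignals.tendsto_gramError (hh : OrthonormalSignals h) (hα : ∀ j, 0 < α j) :
    Tendsto (fun N => gramError N α h) atTop (𝓝 0) := by
  have h0 : (0 : ℝ) = ∑ j : Fin k, ∑ l : Fin k, |Real.sqrt (α j * α l) * (if j = l then 1 else 0) -
      Matrix.diagonal α j l| := by
    refine (Finset.sum_eq_zero fun j _ => Finset.sum_eq_zero fun l _ => ?_).symm
    by_cases hjl : j = l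
    · subst hjl
      simp [Real.sqrt_mul_self (hα j).le]
    · simp [hjl]
  rw [h0]
  exact tendsto_finsetSum _ fun j _ => tendsto_finsetSum _ fun l _ =>
    (((hh.asymptotically_orthonormal j l).const_mul _).sub_const _).abs

theorem abs_orderedEigenvalue_spikeMatrix_sub_le (hθ : 0 ≤ θ) (hα : Antitone α)
    (hα_pos : ∀ j, 0 < α j) (hkN : k ≤ N) (j : Fin k) :
    |orderedEigenvalue (isHermitian_spikeMatrix_mul_transpose (N := N) (θ := θ) (α := α) (h := h)) j
      - θ * α j| ≤ θ * gramError N α h := by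
  have hdiag : (Matrix.diagonal fun j => θ * α j).IsHermitian := isHermitian_diagonal _
  rw [orderedEigenvalue_mul_transpose_eq _ _ isHermitian_transpose_mul_spikeMatrix
    (j.2.trans_le hkN) j.2, ← orderedEigenvalue_diagonal (fun a b hab =>
      mul_le_mul_of_nonneg_left (hα hab) hθ) hdiag]
  refine (abs_orderedEigenvalue_sub_le _ _ _).trans_eq ?_
  rw [gramError, Finset.mul_sum]
  refine Finset.sum_congr rfl fun a _ => ?_
  rw [Finset.mul_sum]
  refine Finset.sum_congr rfl fun b _ => ?_
  have hmul : ∀ y, θ * |y| = |θ * y| := fun y => by rw [abs_mul, abs_of_nonneg hθ]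
  rw [transpose_mul_spikeMatrix_apply hθ hα_pos, hmul]
  congr 1
  by_cases hab : a = b
  · subst hab; simp; ring
  · simp [hab]; ring

/-- The eigenvalues of the deterministic part are separated by a multiple of `θ`. -/
theorem spikeMatrix_gap (hθ : 0 ≤ θ) (hα : Antitone α) (hα_pos : ∀ j, 0 < α j) (hkN : k ≤ N)
    {c : ℝ} (hc : gramError N α h ≤ c) {i : Fin k} (hi : 3 * c ≤ α i)
    (hgap : ∀ j, j ≠ i → 3 * c ≤ |α j - α i|) :
    2 * (c * θ) ≤ orderedEigenvalue
        (isHermitian_spikeMatrix_mul_transpose (N := N) (θ := θ) (α := α) (h := h)) i ∧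
    (∀ j < (i : ℕ), orderedEigenvalue
        (isHermitian_spikeMatrix_mul_transpose (N := N) (θ := θ) (α := α) (h := h)) i + c * θ ≤
      orderedEigenvalue
        (isHermitian_spikeMatrix_mul_transpose (N := N) (θ := θ) (α := α) (h := h)) j) ∧
    ∀ j < N, (i : ℕ) < j → orderedEigenvalue
        (isHermitian_spikeMatrix_mul_transpose (N := N) (θ := θ) (α := α) (h := h)) j ≤
      orderedEigenvalue
        (isHermitian_spikeMatrix_mul_transpose (N := N) (θ := θ) (α := α) (h := h)) i - c * θ := by
  set hD := isHermitian_spikeMatrix_mul_transpose (N := N) (θ := θ) (α := α) (h := h)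
  -- Each eigenvalue moves by at most `cθ` from `θα_j`, so separation `3cθ` of the `θα_j` leaves a
  -- gap `cθ`.
  have key : ∀ j : Fin k, |orderedEigenvalue hD j - θ * α j| ≤ c * θ := fun j =>
    (abs_orderedEigenvalue_spikeMatrix_sub_le hθ hα hα_pos hkN j).trans <| by
      rw [mul_comm]; exact mul_le_mul_of_nonneg_right hc hθ
  have h1 := abs_le.1 (key i)
  have h2 := mul_le_mul_of_nonneg_left hi hθ
  have h3 : 2 * (c * θ) ≤ orderedEigenvalue hD i := by linarith
  have hc0 : 0 ≤ c * θ :=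
    mul_nonneg ((Finset.sum_nonneg fun _ _ => Finset.sum_nonneg fun _ _ => abs_nonneg _).trans hc) hθ
  refine ⟨h3, fun j hj => ?_, fun j hjN hj => ?_⟩
  · let j' : Fin k := ⟨j, hj.trans i.2⟩
    have hj' : j' < i := hj
    have h4 := hgap j' hj'.ne
    rw [abs_of_nonneg (sub_nonneg.2 (hα hj'.le))] at h4
    have h5 := mul_le_mul_of_nonneg_left h4 hθ
    have h6 : -(c * θ) ≤ orderedEigenvalue hD j - θ * α j' := (abs_le.1 (key j')).1
    linarith
  · rcases lt_or_ge j k with hjk | hjk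
    · let j' : Fin k := ⟨j, hjk⟩
      have hj' : i < j' := hj
      have h4 := hgap j' hj'.ne'
      rw [abs_sub_comm, abs_of_nonneg (sub_nonneg.2 (hα hj'.le))] at h4
      have h5 := mul_le_mul_of_nonneg_left h4 hθ
      have h6 : orderedEigenvalue hD j - θ * α j' ≤ c * θ := (abs_le.1 (key j')).2
      linarith
    -- Beyond the rank the eigenvalues are nonpositive, and `λ_i(D) ≥ 2cθ` gives the gap.
    · have := orderedEigenvalue_mul_transpose_nonpos (spikeMatrix N θ α h) hD hjN hjk
      linarith

variable {Ω : Type*} [MeasurableSpace Ω] {P : Measure Ω} [IsProbabilityMeasure P]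
  {X : Fin N → Fin N → Ω → ℝ} {f : ℝ → ℝ → ℝ} {B : ℝ}

theorem IsWignerArray.integrable_orderedEigenvalue_perturbedMatrix (hX : IsWignerArray P X f B)
    (θ : ℝ) (α : Fin k → ℝ) (h : Fin k → ℝ → ℝ) (i : ℕ) :
    Integrable (fun ω => orderedEigenvalue
      (perturbedMatrix_isHermitian (fun a b => X a b ω) θ α h) i) P := by
  refine integrable_orderedEigenvalue _ (fun a b => ?_) (fun a b => ?_) i
  · exact (hX.measurable_entry (edge a b)).add_const _
  · exact (hX.integrable_entry (edge a b)).add (integrable_const _)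

/-- The vector `v` depends on `D` alone, so the linear term `v'Wv` can be subtracted inside the
expectation at no cost. -/
theorem IsWignerArray.abs_integral_orderedEigenvalue_sub_le (hX : IsWignerArray P X f B)
    (hB : 0 < B) (hθ : 0 < θ) (hα : Antitone α) (hα_pos : ∀ j, 0 < α j) (hkN : k ≤ N) {c : ℝ}
    (hc0 : 0 < c) (hc : gramError N α h ≤ c) {i : Fin k} (hi : 3 * c ≤ α i)
    (hgap : ∀ j, j ≠ i → 3 * c ≤ |α j - α i|) :
    |∫ ω, orderedEigenvalue (perturbedMatrix_isHermitian (fun a b => X a b ω) θ α h) i ∂P -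
      orderedEigenvalue
        (isHermitian_spikeMatrix_mul_transpose (N := N) (θ := θ) (α := α) (h := h)) i| ≤
      2 / (c * θ) * (momentBound B ^ 2 * N) +
        2048 / (c * θ) ^ 5 * (4 ^ 6 * momentBound B ^ 6 * (N : ℝ) ^ 4) := by
  obtain ⟨-, hlow, hup⟩ := spikeMatrix_gap hθ.le hα hα_pos hkN hc hi hgap
  set hD := isHermitian_spikeMatrix_mul_transpose (N := N) (θ := θ) (α := α) (h := h)
  obtain ⟨v, hv, hpert⟩ := exists_abs_orderedEigenvalue_add_sub_le hD (i.2.trans_le hkN)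
    (mul_pos hc0 hθ) hlow hup
  have hA := hX.integrable_orderedEigenvalue_perturbedMatrix θ α h i
  have hq := hX.integrable_dotProduct_mulVec v
  have h2 := hX.integrable_mulVec_dotProduct_mulVec v
  have h6 := hX.integrable_sum_sq_pow_three
  have hpt : ∀ ω, |orderedEigenvalue (perturbedMatrix_isHermitian (fun a b => X a b ω) θ α h) i -
      orderedEigenvalue hD i - v ⬝ᵥ (symmMatrix fun a b => X a b ω) *ᵥ v| ≤
      2 / (c * θ) * ((symmMatrix fun a b => X a b ω) *ᵥ v ⬝ᵥ
        (symmMatrix fun a b => X a b ω) *ᵥ v) +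
      2048 / (c * θ) ^ 5 * ∑ a, ∑ b, ((symmMatrix fun a b => X a b ω) ^ 3) a b ^ 2 := fun ω => by
    have hW := symmMatrix_isHermitian fun a b => X a b ω
    rw [orderedEigenvalue_congr (perturbedMatrix_isHermitian (fun a b => X a b ω) θ α h)
      (hW.add hD) (by rw [perturbedMatrix, spikeMatrix_mul_transpose hθ.le hα_pos])]
    exact hpert _ hW _
  have heq : ∫ ω, orderedEigenvalue (perturbedMatrix_isHermitian (fun a b => X a b ω) θ α h) i ∂P -
      orderedEigenvalue hD i =
      ∫ ω, (orderedEigenvalue (perturbedMatrix_isHermitian (fun a b => X a b ω) θ α h) i -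
        orderedEigenvalue hD i - v ⬝ᵥ (symmMatrix fun a b => X a b ω) *ᵥ v) ∂P := by
    have h7 := hA.sub (integrable_const (orderedEigenvalue hD i))
    refine Eq.trans ?_ (integral_sub h7 hq).symm
    rw [hX.integral_dotProduct_mulVec, sub_zero]
    refine Eq.trans ?_ (integral_sub hA (integrable_const (orderedEigenvalue hD i))).symm
    simp
  rw [heq]
  refine abs_integral_le_integral_abs.trans ?_
  refine (integral_mono ((hA.sub (integrable_const _)).sub hq).abs
    ((h2.const_mul _).add (h6.const_mul _)) hpt).trans ?_
  simp only [Pi.add_apply]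
  rw [integral_add (h2.const_mul _) (h6.const_mul _), integral_const_mul, integral_const_mul]
  have h3 := hX.integral_mulVec_dotProduct_mulVec_le hB v
  rw [hv, mul_one] at h3
  have h4 := hX.integral_sum_sq_pow_three_le hB
  have := mul_pos hc0 hθ
  exact add_le_add (mul_le_mul_of_nonneg_left h3 (by positivity))
    (mul_le_mul_of_nonneg_left h4 (by positivity))

theorem IsWignerArray.abs_orderedEigenvalue_meanMatrix_sub_le (hX : IsWignerArray P X f B)
    (hB : 0 < B) (hθ : 0 < θ) (hα_pos : ∀ j, 0 < α j) (hkN : k ≤ N) (i : Fin k)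
    (he : ∀ j, discretize N (h j) ⬝ᵥ discretize N (h j) ≤ 2) :
    |orderedEigenvalue (meanMatrix_isHermitian P X θ α h i) i - orderedEigenvalue
        (isHermitian_spikeMatrix_mul_transpose (N := N) (θ := θ) (α := α) (h := h)) i| ≤
      (∑ j, ∑ l, Real.sqrt (α j * α l)) * (momentBound B ^ 2 * 4) / α i ^ 2 * (N / θ) := by
  rw [orderedEigenvalue_mul_transpose_eq _ _ isHermitian_transpose_mul_spikeMatrix
    (i.2.trans_le hkN) i.2]
  refine (abs_orderedEigenvalue_sub_le _ _ _).trans ?_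
  simp only [Finset.sum_mul, Finset.sum_div]
  refine Finset.sum_le_sum fun j _ => Finset.sum_le_sum fun l _ => ?_
  rw [transpose_mul_spikeMatrix_apply hθ.le hα_pos, meanMatrix, of_apply, add_sub_cancel_left,
    abs_div, abs_mul, abs_of_nonneg (Real.sqrt_nonneg _)]
  have hαi := hα_pos i
  rw [abs_of_pos (by positivity : 0 < θ * α i ^ 2)]
  have h1 := hX.abs_integral_dotProduct_sq_mulVec_le hB (discretize N (h j)) (discretize N (h l))
  have h2 : momentBound B ^ 2 * N * (discretize N (h j) ⬝ᵥ discretize N (h j) +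
      discretize N (h l) ⬝ᵥ discretize N (h l)) ≤ momentBound B ^ 2 * N * 4 :=
    mul_le_mul_of_nonneg_left (by linarith [he j, he l]) (by positivity)
  calc _ ≤ Real.sqrt (α j * α l) * (momentBound B ^ 2 * N * 4) / (θ * α i ^ 2) := by
        gcongr
        exact h1.trans h2
    _ = _ := by field_simp

end Spike

/-! ### Constants and asymptotics. -/

theorem exists_gap {k : ℕ} {α : Fin k → ℝ} (hα : StrictAnti α) (hα_pos : ∀ j, 0 < α j)
    (i : Fin k) : ∃ c, 0 < c ∧ 3 * c ≤ α i ∧ ∀ j, j ≠ i → 3 * c ≤ |α j - α i| := by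
  have hev : ∀ a : ℝ, 0 < a → ∀ᶠ c in 𝓝[>] (0 : ℝ), 3 * c ≤ a := fun a ha => by
    have : Continuous fun c : ℝ => 3 * c := by fun_prop
    exact ((this.tendsto 0).mono_left nhdsWithin_le_nhds).eventually_le_const (by simpa using ha)
  have h1 : ∀ᶠ c in 𝓝[>] (0 : ℝ), ∀ j, j ≠ i → 3 * c ≤ |α j - α i| := by
    refine eventually_all.2 fun j => ?_
    by_cases hj : j = i
    · simp [hj]
    · filter_upwards [hev _ (abs_pos.2 (sub_ne_zero.2 (hα.injective.ne hj)))] with c hc _ using hc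
  obtain ⟨c, hc0, hc1, hc2⟩ := 
    (eventually_mem_nhdsWithin.and ((hev _ (hα_pos i)).and h1)).exists
  exact ⟨c, hc0, hc1, hc2⟩

theorem eventually_sq_le_mul_pow_three {θ : ℕ → ℝ} (hθ_pos : ∀ N, 1 ≤ N → 0 < θ N)
    (hθ : (fun N : ℕ => (N : ℝ) ^ (2 / 3 : ℝ)) =o[atTop] θ) {δ : ℝ} (hδ : 0 < δ) :
    ∀ᶠ N : ℕ in atTop, (N : ℝ) ^ 2 ≤ δ * θ N ^ 3 := by
  have hε : 0 < min 1 δ := lt_min one_pos hδ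
  filter_upwards [hθ.def hε, eventually_ge_atTop 1] with N hN h1
  have hθN := hθ_pos N h1
  rw [Real.norm_of_nonneg (by positivity), Real.norm_of_nonneg hθN.le] at hN
  have h3 := pow_le_pow_left₀ (by positivity) hN 3
  rw [← Real.rpow_natCast, ← Real.rpow_mul (by positivity), mul_pow] at h3
  norm_num at h3
  refine h3.trans ?_
  gcongr
  calc min 1 δ ^ 3 ≤ min 1 δ := pow_le_of_le_one hε.le (min_le_left _ _) (by norm_num)
    _ ≤ δ := min_le_right _ _

end SpikedWigner

theorem mainTheorem5 {Ω : ℕ → Type*} [∀ N, MeasurableSpace (Ω N)]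
    (P : ∀ N, Measure (Ω N)) [∀ N, IsProbabilityMeasure (P N)]
    (f : ℝ → ℝ → ℝ) (hf : SpikedWigner.IsVarianceProfile f)
    (B : ℝ) (hB : 0 < B)
    (X : ∀ N, Fin N → Fin N → Ω N → ℝ)
    (hX : ∀ N, SpikedWigner.IsWignerArray (P N) (X N) f B)
    (k : ℕ) (α : Fin k → ℝ) (hα : StrictAnti α) (hα_pos : ∀ i, 0 < α i)
    (h : Fin k → ℝ → ℝ) (hh : SpikedWigner.OrthonormalSignals h)
    (θ : ℕ → ℝ) (hθ_pos : ∀ N, 1 ≤ N → 0 < θ N)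
    (hθ : SpikedWigner.GrowthCondition θ B)
    (hθ_large : (fun N : ℕ => (N : ℝ) ^ (2 / 3 : ℝ)) =o[atTop] θ)
    (i : Fin k) :
    (∀ N, Integrable (fun ω => SpikedWigner.orderedEigenvalue
        (SpikedWigner.perturbedMatrix_isHermitian (fun a b => X N a b ω) (θ N) α h) i) (P N)) ∧
    ∃ r : ℕ → ℝ, (r =O[atTop] fun N : ℕ => (N : ℝ) ^ 2 / θ N ^ 3) ∧
      ∀ᶠ N : ℕ in atTop,
        ∫ ω, SpikedWigner.orderedEigenvalue
            (SpikedWigner.perturbedMatrix_isHermitian (fun a b => X N a b ω) (θ N) α h) i ∂(P N) =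
          SpikedWigner.orderedEigenvalue
            (SpikedWigner.meanMatrix_isHermitian (P N) (X N) (θ N) α h i) i * (1 + r N) := by
  refine ⟨fun N => (hX N).integrable_orderedEigenvalue_perturbedMatrix _ _ _ _, ?_⟩
  obtain ⟨c, hc0, hci, hgap⟩ := SpikedWigner.exists_gap hα hα_pos i
  obtain ⟨-, -, -, hθN⟩ := hθ
  obtain ⟨C₀, hC₀, hθ_le⟩ := hθN.exists_pos
  rw [isBigOWith_iff] at hθ_le
  have hαi := hα_pos i
  set K := SpikedWigner.momentBound B with hK
  have hK0 : 0 < K := zero_lt_one.trans_le (SpikedWigner.one_le_momentBound hB)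
  set C₁ := (∑ j, ∑ l, Real.sqrt (α j * α l)) * (K ^ 2 * 4) / α i ^ 2 with hC₁
  have hC₁0 : 0 ≤ C₁ := by positivity
  set C₂ := 2 / c * K ^ 2 with hC₂
  set C₃ := 2048 / c ^ 5 * (4 ^ 6 * K ^ 6) with hC₃
  have hC₂0 : 0 ≤ C₂ := by positivity
  have hC₃0 : 0 ≤ C₃ := by positivity
  let m : ℕ → ℝ := fun N => ∫ ω, SpikedWigner.orderedEigenvalue
    (SpikedWigner.perturbedMatrix_isHermitian (fun a b => X N a b ω) (θ N) α h) i ∂(P N)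
  let b : ℕ → ℝ := fun N => SpikedWigner.orderedEigenvalue
    (SpikedWigner.meanMatrix_isHermitian (P N) (X N) (θ N) α h i) i
  have hev : ∀ᶠ N : ℕ in atTop, 1 ≤ N ∧ 0 < θ N ∧ c * θ N ≤ b N ∧ θ N ≤ C₀ * N ∧
      (N : ℝ) ^ 2 ≤ θ N ^ 3 ∧
      |m N - b N| ≤ (C₁ + C₂) * (N / θ N) + C₃ * ((N : ℝ) ^ 4 / θ N ^ 5) := by
    have he : ∀ᶠ N : ℕ in atTop, ∀ j,
        SpikedWigner.discretize N (h j) ⬝ᵥ SpikedWigner.discretize N (h j) ≤ 2 :=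
      eventually_all.2 fun j => by
        have := hh.asymptotically_orthonormal j j
        rw [if_pos rfl] at this
        exact this.eventually_le_const one_lt_two
    filter_upwards [eventually_ge_atTop 1, eventually_ge_atTop k, hθ_le, he,
      (hh.tendsto_gramError hα_pos).eventually_le_const hc0,
      SpikedWigner.eventually_sq_le_mul_pow_three hθ_pos hθ_large one_pos,
      SpikedWigner.eventually_sq_le_mul_pow_three hθ_pos hθ_large
        (by positivity : 0 < c ^ 2 / (C₁ ^ 2 + 1))] with N h1 hkN hθle he hgram hsq hsq'
    have hθ0 := hθ_pos N h1
    have hN1 : (1 : ℝ) ≤ N := by exact_mod_cast h1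
    have hm := (hX N).abs_integral_orderedEigenvalue_sub_le hB hθ0 hα.antitone hα_pos hkN hc0 hgram
      hci hgap
    have hb := (hX N).abs_orderedEigenvalue_meanMatrix_sub_le hB hθ0 hα_pos hkN i he
    have hd := (SpikedWigner.spikeMatrix_gap hθ0.le hα.antitone hα_pos hkN hgram hci hgap).1
    generalize SpikedWigner.orderedEigenvalue (SpikedWigner.isHermitian_spikeMatrix_mul_transpose
      (N := N) (θ := θ N) (α := α) (h := h)) i = d at hm hb hd
    rw [one_mul] at hsq
    rw [Real.norm_of_nonneg hθ0.le, Real.norm_of_nonneg (by positivity)] at hθle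
    have hθ1 : 1 ≤ θ N := by
      refine le_of_pow_le_pow_left₀ (n := 3) (by norm_num) hθ0.le ?_
      exact (one_pow 3).trans_le ((one_le_pow₀ hN1).trans hsq)
    -- This keeps `λ_i(B)` above `2cθ - cθ`. The `+ 1` in `c² / (C₁² + 1)` guards against `C₁ = 0`;
    -- `θ ≥ 1` turns `θ³` into `θ⁴`.
    have hsmall : C₁ * (N / θ N) ≤ c * θ N := by
      rw [mul_div_assoc', div_le_iff₀ hθ0]
      refine abs_le_of_sq_le_sq' ?_ (by positivity) |>.2
      rw [div_mul_eq_mul_div, le_div_iff₀ (by positivity)] at hsq'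
      calc (C₁ * N) ^ 2 ≤ (N : ℝ) ^ 2 * (C₁ ^ 2 + 1) := by nlinarith [sq_nonneg (N : ℝ)]
        _ ≤ c ^ 2 * θ N ^ 3 := hsq'
        _ ≤ c ^ 2 * θ N ^ 4 := by gcongr; norm_num
        _ = (c * θ N * θ N) ^ 2 := by ring
    have hm' : |m N - d| ≤ C₂ * (N / θ N) + C₃ * ((N : ℝ) ^ 4 / θ N ^ 5) := by
      refine hm.trans_eq ?_
      rw [hC₂, hC₃, ← hK]
      field_simp
    refine ⟨h1, hθ0, ?_, hθle, hsq, ?_⟩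
    · have := (abs_le.1 hb).1
      change c * θ N ≤ SpikedWigner.orderedEigenvalue _ _
      linarith
    · have hb' : |b N - d| ≤ C₁ * (N / θ N) := hb
      calc |m N - b N| ≤ |m N - d| + |d - b N| := abs_sub_le _ _ _
        _ ≤ _ := by rw [abs_sub_comm d]; linarith
  refine ⟨fun N => (m N - b N) / b N, IsBigO.of_bound (((C₁ + C₂) * C₀ + C₃) / c) ?_, ?_⟩
  · filter_upwards [hev] with N ⟨h1, hθ0, hb, hθle, hsq, hmb⟩
    have hN0 : (0 : ℝ) < N := by exact_mod_cast h1
    have hcθ : 0 < c * θ N := by positivity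
    rw [Real.norm_eq_abs, abs_div, abs_of_pos (hcθ.trans_le hb), Real.norm_of_nonneg (by positivity)]
    -- Here `θ = O(N)` makes the second-order term negligible at the claimed precision.
    have e1 : (N : ℝ) / θ N ≤ C₀ * ((N : ℝ) ^ 2 / θ N ^ 2) := by
      rw [mul_div_assoc', div_le_div_iff₀ hθ0 (by positivity)]
      calc (N : ℝ) * θ N ^ 2 = N * θ N * θ N := by ring
        _ ≤ N * θ N * (C₀ * N) := by gcongr
        _ = _ := by ring
    -- Here `N² ≤ θ³` absorbs the sixth-moment term.
    have e2 : (N : ℝ) ^ 4 / θ N ^ 5 ≤ (N : ℝ) ^ 2 / θ N ^ 2 := by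
      rw [div_le_div_iff₀ (by positivity) (by positivity)]
      calc (N : ℝ) ^ 4 * θ N ^ 2 = N ^ 2 * θ N ^ 2 * N ^ 2 := by ring
        _ ≤ N ^ 2 * θ N ^ 2 * θ N ^ 3 := by gcongr
        _ = _ := by ring
    calc |m N - b N| / b N ≤ |m N - b N| / (c * θ N) := by gcongr
      _ ≤ ((C₁ + C₂) * (C₀ * ((N : ℝ) ^ 2 / θ N ^ 2)) + C₃ * ((N : ℝ) ^ 2 / θ N ^ 2)) /
          (c * θ N) := by
        gcongr
        exact hmb.trans (by gcongr)
      _ = _ := by field_simp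
  · filter_upwards [hev] with N ⟨h1, hθ0, hb, _, _, _⟩
    have hb0 : b N ≠ 0 := ((mul_pos hc0 hθ0).trans_le hb).ne'
    change m N = b N * (1 + (m N - b N) / b N)
    field_simp
    ring
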